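/- Let $X$ be a sequentially complete Hausdorff locally convex space over $\mathbb C$, let $\mathcal L(X)$ be the space of continuous linear operators on $X$, and let $\mathcal L_b(X)$ be $\mathcal L(X)$ with the topology of uniform convergence on bounded subsets of $X$. Let $(T(t))_{t\ge 0}\subseteq\mathcal L(X)$ be a semigroup ($T(0)=\mathrm{id}$, $T(t+s)=T(t)T(s)$) which is strongly continuous ($t\mapsto T(t)x$ is continuous on $[0,\infty)$ for each $x\in X$), locally equicontinuous (for every continuous seminorm $q$ and every $t_0\ge 0$ there are a continuous seminorm $p$ and $C\ge 0$ with $q(T(t)x)\le C\,p(x)$ for all $t\in[0,t_0]$, $x\in X$) and periodic ($T(t_0)=\mathrm{id}$ for some $t_0>0$) with period $\rho:=\inf\{t_0>0 \mid T(t_0)=\mathrm{id}\}>0$. Let $(A,D(A))$ be its generator: $D(A)$ is the set of all $x\in X$ for which $Ax:=\lim_{t\to0+}\frac{T(t)x-x}{t}$ exists in $X$. The resolvent set $\rho(A)$ is the set of all $\mu\in\mathbb C$ such that $\mu-A\colon D(A)\to X$ is bijective with $R(\mu,A):=(\mu-A)^{-1}\in\mathcal L(X)$. Let $\rho^*(A)$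 be the set of all $\mu\in\rho(A)$ for which there is $\delta>0$ such that $B(\mu,\delta):=\{\eta\in\mathbb C \mid |\eta-\mu|<\delta\}\subseteq\rho(A)$ and $\{R(\eta,A) \mid \eta\in B(\mu,\delta)\}$ is equicontinuous. Put $\sigma^*(A):=\mathbb C\setminus\rho^*(A)$, $\sigma_p(A):=\{\mu\in\mathbb C \mid \mu-A\text{ is not injective}\}$ and $\mu_n:=\frac{2\pi i n}{\rho}$ for $n\in\mathbb Z$. All integrals are Riemann integrals, and their existence is part of the claim. Then the following hold. (a) $\sigma^*(A)\subseteq\frac{2\pi i}{\rho}\mathbb Z$, and for all $\mu\notin\frac{2\pi i}{\rho}\mathbb Z$ and $x\in X$ $$R(\mu,A)x=(1-e^{-\mu\rho})^{-1}\int_0^\rho e^{-\mu s}T(s)x\,ds .$$ (b) The map $R(\cdot,A)\colon\mathbb C\setminus\frac{2\pi i}{\rho}\mathbb Z\to\mathcal L_b(X)$ is holomorphic. For every $n\in\mathbb Z$ the limit $P_n:=\lim_{\mu\to\mu_n}(\mu-\mu_n)R(\mu,A)$ exists in $\mathcal L_b(X)$, and $P_nx=\frac1\rho\int_0^\rho e^{-\mu_ns}T(s)x\,ds$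 for all $x\in X$. (So the singularity at $\mu_n$ is at most a simple pole; $P_n=0$ is possible.) (c) For all $n\in\mathbb Z$ and $x\in X$ we have the Laurent expansion $$R(\mu,A)x=\sum_{k=-1}^\infty a_{k,n}(x)(\mu-\mu_n)^k,\qquad 0<|\mu-\mu_n|<\tfrac{2\pi}{\rho},$$ which converges locally uniformly in $X$. Here, for all $k\ge -1$ and every $0<r<\frac{2\pi}{\rho}$, $$a_{k,n}(x)=\frac1{2\pi i}\int_{\partial B(\mu_n,r)}\frac{R(\lambda,A)x}{(\lambda-\mu_n)^{k+1}}\,d\lambda ,$$ where the circle $\partial B(\mu_n,r)$ is positively oriented. Moreover $a_{-1,n}=P_n$, and $a_{k,n}\in\mathcal L(X)$ for all $k\ge-1$ and $n\in\mathbb Z$. If in addition $\mathcal L_b(X)$ is sequentially complete, then the Laurent series $R(\mu,A)=\sum_{k=-1}^\infty a_{k,n}(\mu-\mu_n)^k$ converges locally uniformly on $0<|\mu-\mu_n|<\frac{2\pi}{\rho}$ in $\mathcal L_b(X)$, and $a_{k,n}=\frac1{2\pi i}\int_{\partial B(\mu_n,r)}\frac{R(\lambda,A)}{(\lambda-\mu_n)^{k+1}}\,d\lambda$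 as Riemann integrals in $\mathcal L_b(X)$. (d) For every $n\in\mathbb Z$, $\operatorname{ran}(P_n)=\ker(\mu_n-A)$ and $P_n$ is a projection, i.e. $P_n^2=P_n$. (e) $\sigma^*(A)=\sigma_p(A)\subseteq\frac{2\pi i}{\rho}\mathbb Z$. -/

import Mathlib

open Filter Topology Set
open scoped NNReal

noncomputable section

namespace LCSemigroup

/-- A uniform space is sequentially complete if every Cauchy sequence converges. -/
def SeqComplete (Y : Type*) [UniformSpace Y] : Prop :=
  ∀ u : ℕ → Y, CauchySeq u → ∃ y : Y, Tendsto u atTop (𝓝 y)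

section Riemann

variable {Y : Type*} [AddCommGroup Y] [Module ℂ Y] [TopologicalSpace Y]

/-- `f : ℝ → Y` is Riemann integrable on `[a, b]` (where `a ≤ b`) with integral `y`: the Riemann
sums over tagged partitions `a = t 0 ≤ t 1 ≤ ⋯ ≤ t n = b`, `ξ i ∈ [t i, t (i + 1)]`, converge
to `y` in the topology of `Y` as the mesh of the partition tends to `0`. -/
def HasRiemannIntegral (f : ℝ → Y) (a b : ℝ) (y : Y) : Prop :=
  ∀ U ∈ 𝓝 y, ∃ δ > (0 : ℝ), ∀ (n : ℕ) (t ξ : ℕ → ℝ),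
    t 0 = a → t n = b →
    (∀ i < n, t i ≤ ξ i ∧ ξ i ≤ t (i + 1) ∧ t (i + 1) - t i < δ) →
    ∑ i ∈ Finset.range n, ((t (i + 1) - t i : ℝ) : ℂ) • f (ξ i) ∈ U

/-- The contour integral of `f : ℂ → Y` over the positively oriented circle with centre `c` and
radius `r` exists as a Riemann integral and equals `y`. -/
def HasCircleIntegral (f : ℂ → Y) (c : ℂ) (r : ℝ) (y : Y) : Prop :=
  HasRiemannIntegral (fun θ : ℝ => deriv (circleMap c r) θ • f (circleMap c r θ))
    0 (2 * Real.pi) y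

end Riemann

section Semigroup

variable {X : Type*} [AddCommGroup X] [Module ℂ X] [TopologicalSpace X]

/-- A one-parameter semigroup of continuous linear operators. -/
structure IsSemigroup (T : ℝ≥0 → X →L[ℂ] X) : Prop where
  map_zero : T 0 = ContinuousLinearMap.id ℂ X
  map_add : ∀ t s : ℝ≥0, T (t + s) = (T t).comp (T s)

/-- Strong continuity: continuity for the topology of pointwise convergence on `X →L[ℂ] X`. -/
def IsStronglyContinuous (T : ℝ≥0 → X →L[ℂ] X) : Prop :=
  ∀ x : X, Continuous fun t : ℝ≥0 => T t x

/-- Local equicontinuity, with respect to the fundamental system of all continuous seminorms. -/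
def IsLocallyEquicontinuous (T : ℝ≥0 → X →L[ℂ] X) : Prop :=
  ∀ q : Seminorm ℂ X, Continuous q → ∀ t₀ : ℝ≥0,
    ∃ p : Seminorm ℂ X, Continuous p ∧ ∃ C : ℝ, 0 ≤ C ∧
      ∀ t ≤ t₀, ∀ x : X, q (T t x) ≤ C * p x

/-- A semigroup is periodic if `T t₀ = id` for some `t₀ > 0`. -/
def IsPeriodic (T : ℝ≥0 → X →L[ℂ] X) : Prop :=
  ∃ t₀ : ℝ≥0, 0 < t₀ ∧ T t₀ = ContinuousLinearMap.id ℂ X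

/-- The (minimal) period `inf {t₀ > 0 | T t₀ = id}`. -/
def period (T : ℝ≥0 → X →L[ℂ] X) : ℝ≥0 :=
  sInf {t₀ : ℝ≥0 | 0 < t₀ ∧ T t₀ = ContinuousLinearMap.id ℂ X}

/-- `y = lim_{t → 0+} (T t x - x) / t`. -/
def HasGeneratorValue (T : ℝ≥0 → X →L[ℂ] X) (x y : X) : Prop :=
  Tendsto (fun t : ℝ≥0 => ((t : ℝ) : ℂ)⁻¹ • (T t x - x)) (𝓝[>] 0) (𝓝 y)

theorem HasGeneratorValue.add [IsTopologicalAddGroup X] {T : ℝ≥0 → X →L[ℂ] X} {x x' y y' : X}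
    (h : HasGeneratorValue T x y) (h' : HasGeneratorValue T x' y') :
    HasGeneratorValue T (x + x') (y + y') := by
  refine (Tendsto.add h h').congr fun t => ?_
  rw [← smul_add, map_add]
  congr 1
  abel

theorem HasGeneratorValue.smul [ContinuousSMul ℂ X] {T : ℝ≥0 → X →L[ℂ] X} {x y : X} (c : ℂ)
    (h : HasGeneratorValue T x y) : HasGeneratorValue T (c • x) (c • y) := by
  refine (Tendsto.const_smul h c).congr fun t => ?_
  rw [smul_comm, map_smul, ← smul_sub]

theorem HasGeneratorValue.zero (T : ℝ≥0 → X →L[ℂ] X) : HasGeneratorValue T 0 0 := by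
  simpa [HasGeneratorValue] using! tendsto_const_nhds

theorem HasGeneratorValue.unique [T2Space X] {T : ℝ≥0 → X →L[ℂ] X} {x y y' : X}
    (h : HasGeneratorValue T x y) (h' : HasGeneratorValue T x y') : y = y' :=
  tendsto_nhds_unique h h'

/-- The generator `(A, D(A))`: its domain consists of those `x` for which
`lim_{t → 0+} (T t x - x) / t` exists in `X`, and its value at `x` is this limit. -/
def generator [IsTopologicalAddGroup X] [ContinuousSMul ℂ X] [T2Space X]
    (T : ℝ≥0 → X →L[ℂ] X) : X →ₗ.[ℂ] X where
  domain :=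
    { carrier := {x | ∃ y, HasGeneratorValue T x y}
      zero_mem' := ⟨0, .zero T⟩
      add_mem' := fun ⟨_, h⟩ ⟨_, h'⟩ => ⟨_, h.add h'⟩
      smul_mem' := fun c _ ⟨_, h⟩ => ⟨_, h.smul c⟩ }
  toFun :=
    { toFun := fun x => Classical.choose x.2
      map_add' := fun x x' => (Classical.choose_spec (x + x').2).unique
        ((Classical.choose_spec x.2).add (Classical.choose_spec x'.2))
      map_smul' := fun c x => (Classical.choose_spec (c • x).2).unique
        ((Classical.choose_spec x.2).smul c) }

theorem mem_generator_domain [IsTopologicalAddGroup X] [ContinuousSMul ℂ X] [T2Space X]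
    (T : ℝ≥0 → X →L[ℂ] X) (x : X) :
    x ∈ (generator T).domain ↔ ∃ y, HasGeneratorValue T x y := Iff.rfl

theorem generator_spec [IsTopologicalAddGroup X] [ContinuousSMul ℂ X] [T2Space X]
    (T : ℝ≥0 → X →L[ℂ] X) (x : (generator T).domain) :
    HasGeneratorValue T x (generator T x) :=
  Classical.choose_spec x.2

end Semigroup

section Spectrum

/-- The operator `μ - A : D(A) → X`. -/
def scalarSub {X : Type*} [AddCommGroup X] [Module ℂ X] (A : X →ₗ.[ℂ] X) (μ : ℂ) :
    A.domain →ₗ[ℂ] X :=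
  μ • A.domain.subtype - A.toFun

/-- The eigenspace `ker (μ - A) ⊆ D(A)`, as a subspace of `X`. -/
def kerScalarSub {X : Type*} [AddCommGroup X] [Module ℂ X] (A : X →ₗ.[ℂ] X) (μ : ℂ) :
    Submodule ℂ X :=
  (LinearMap.ker (scalarSub A μ)).map A.domain.subtype

/-- The point spectrum. -/
def pointSpec {X : Type*} [AddCommGroup X] [Module ℂ X] (A : X →ₗ.[ℂ] X) : Set ℂ :=
  {μ | ¬ Function.Injective (scalarSub A μ)}

/-- The resolvent set: `μ - A : D(A) → X` is bijective and its inverse is a continuous linear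
operator on `X`. -/
def resolventDomain {X : Type*} [AddCommGroup X] [Module ℂ X] [TopologicalSpace X]
    (A : X →ₗ.[ℂ] X) : Set ℂ :=
  {μ | Function.Bijective (scalarSub A μ) ∧
    ∃ R : X →L[ℂ] X, ∀ x : A.domain, R (scalarSub A μ x) = x}

open scoped Classical in
/-- The resolvent `R(μ, A) = (μ - A)⁻¹` for `μ` in the resolvent set (and `0` elsewhere). -/
def res {X : Type*} [AddCommGroup X] [Module ℂ X] [TopologicalSpace X]
    (A : X →ₗ.[ℂ] X) (μ : ℂ) : X →L[ℂ] X :=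
  if h : μ ∈ resolventDomain A then Classical.choose h.2 else 0

theorem res_scalarSub {X : Type*} [AddCommGroup X] [Module ℂ X] [TopologicalSpace X]
    {A : X →ₗ.[ℂ] X} {μ : ℂ} (h : μ ∈ resolventDomain A) (x : A.domain) :
    res A μ (scalarSub A μ x) = x := by
  rw [res, dif_pos h]
  exact Classical.choose_spec h.2 x

theorem scalarSub_res {X : Type*} [AddCommGroup X] [Module ℂ X] [TopologicalSpace X]
    {A : X →ₗ.[ℂ] X} {μ : ℂ} (h : μ ∈ resolventDomain A) (x : X) :
    ∃ hx : res A μ x ∈ A.domain, scalarSub A μ ⟨res A μ x, hx⟩ = x := by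
  obtain ⟨z, rfl⟩ := h.1.2 x
  have hz := res_scalarSub h z
  refine ⟨hz ▸ z.2, ?_⟩
  congr 1
  exact Subtype.ext hz

/-- The set `ρ*(A)` of all `μ` in the resolvent set such that some open disc around `μ` is
contained in the resolvent set and the resolvents on that disc form an equicontinuous family. -/
def resolventDomainStar {X : Type*} [AddCommGroup X] [Module ℂ X] [UniformSpace X]
    (A : X →ₗ.[ℂ] X) : Set ℂ :=
  {μ | μ ∈ resolventDomain A ∧ ∃ δ > (0 : ℝ), Metric.ball μ δ ⊆ resolventDomain A ∧
    Equicontinuous fun (η : Metric.ball μ δ) (x : X) => res A η x}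

/-- The spectrum `σ*(A) = ℂ \ ρ*(A)`. -/
def specStar {X : Type*} [AddCommGroup X] [Module ℂ X] [UniformSpace X]
    (A : X →ₗ.[ℂ] X) : Set ℂ :=
  (resolventDomainStar A)ᶜ

end Spectrum

/-- `μ_n = 2πin / ρ`. -/
def latticePoint (ρ : ℝ≥0) (n : ℤ) : ℂ :=
  2 * (Real.pi : ℂ) * Complex.I * (n : ℂ) / ((ρ : ℝ) : ℂ)

/-- The set `(2πi / ρ) ℤ`. -/
def lattice (ρ : ℝ≥0) : Set ℂ :=
  Set.range (latticePoint ρ)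

/-- The punctured open disc `{μ | 0 < |μ - c| < r}`. -/
def puncturedDisc (c : ℂ) (r : ℝ) : Set ℂ :=
  {μ | 0 < ‖μ - c‖ ∧ ‖μ - c‖ < r}

end LCSemigroup

end

open LCSemigroup

open Filter Topology Set
open scoped NNReal

noncomputable section

/-! All the analysis takes place in the Banach space `C([0,ρ], ℂ)` and is transported to operators
by one map `I`, where `I φ x` is the integral of `φ(s) T(s)x` over `[0,ρ]`. Sequential completeness
yields these integrals, and local equicontinuity makes `I` continuous into the operators with the
topology of uniform convergence on bounded sets (`exists_isOrbitIntegral`).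

Write `e_μ(s) = exp(-μs)` and `ω(μ) = 1 - exp(-μρ)`. Since `T(ρ) = id`, differentiating `t ↦ T(t)
I(e_μ)x` at `0` gives `(μ - A) I(e_μ) = ω(μ)`, and `I(e_μ)(μ - A) = ω(μ)` on `D(A)`. Off the
lattice, which is the zero set of `ω`, this means `R(μ,A) = I(ω(μ)⁻¹ e_μ)` (`res_generator`). Its
argument is a meromorphic function with values in a Banach space, with simple poles because `ω' = ρ`
on the lattice. Holomorphy, residues and Laurent series are obtained there and mapped by `I`, or by
`φ ↦ I φ x`.

At a lattice point `c`, the range of `I(e_c)` lies in `ker(c - A)`, and `I(e_c) = ρ` on that kernel;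
hence `I(e_c)/ρ` is the projection onto the eigenspace. If `c` is no eigenvalue, then `I(e_c) = 0`,
so `e_η` may be replaced by `e_η - e_c`: the singularity is removable and `c` belongs to `ρ*(A)`
(`mem_resolventDomainStar_of_injective`). -/

namespace LCSemigroup

/-! ### Riemann sums of continuous functions with values in a Banach space. -/

section Banach

variable {E : Type*} [NormedAddCommGroup E] [NormedSpace ℂ E] [CompleteSpace E]

theorem partition_mem_Icc {n : ℕ} {t ξ : ℕ → ℝ}
    (h : ∀ i < n, t i ≤ ξ i ∧ ξ i ≤ t (i + 1)) :
    ∀ i ≤ n, t 0 ≤ t i ∧ t i ≤ t n := by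
  have key : ∀ i j, i ≤ j → j ≤ n → t i ≤ t j := by
    intro i j hij
    induction j, hij using Nat.le_induction with
    | base => intro _; exact le_rfl
    | succ j _ ih =>
      intro hj
      exact (ih (by omega)).trans ((h j (by omega)).1.trans (h j (by omega)).2)
  exact fun i hi => ⟨key 0 i (Nat.zero_le _) hi, key i n hi le_rfl⟩

/-- By uniform continuity on `[a, b]`, each subinterval contributes an error of at most `ε` times
its length, and the lengths telescope. -/
theorem exists_norm_riemannSum_sub_integral_le {f : ℝ → E} (hf : Continuous f) (a b : ℝ)
    {ε : ℝ} (hε : 0 < ε) :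
    ∃ δ > (0 : ℝ), ∀ (n : ℕ) (t ξ : ℕ → ℝ), t 0 = a → t n = b →
      (∀ i < n, t i ≤ ξ i ∧ ξ i ≤ t (i + 1) ∧ t (i + 1) - t i < δ) →
      ‖∑ i ∈ Finset.range n, ((t (i + 1) - t i : ℝ) : ℂ) • f (ξ i) - ∫ s in a..b, f s‖
        ≤ ε * (b - a) := by
  have huc := isCompact_Icc.uniformContinuousOn_of_continuous (hf.continuousOn (s := Icc a b))
  obtain ⟨δ, hδ, H⟩ := Metric.uniformContinuousOn_iff.1 huc ε hε
  refine ⟨δ, hδ, fun n t ξ h0 hn h => ?_⟩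
  have hmono := partition_mem_Icc fun i hi => ⟨(h i hi).1, (h i hi).2.1⟩
  have hint : ∫ s in a..b, f s = ∑ i ∈ Finset.range n, ∫ s in t i..t (i + 1), f s := by
    rw [← h0, ← hn, intervalIntegral.sum_integral_adjacent_intervals]
    exact fun k _ => hf.intervalIntegrable _ _
  have htel : ε * (b - a) = ∑ i ∈ Finset.range n, ε * (t (i + 1) - t i) := by
    rw [← Finset.mul_sum, Finset.sum_range_sub, h0, hn]
  rw [hint, htel, ← Finset.sum_sub_distrib]
  refine norm_sum_le_of_le _ fun i hi => ?_
  have hi := Finset.mem_range.1 hi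
  obtain ⟨h1, h2, h3⟩ := h i hi
  have hle : t i ≤ t (i + 1) := h1.trans h2
  have e1 : ((t (i + 1) - t i : ℝ) : ℂ) • f (ξ i) = ∫ _ in t i..t (i + 1), f (ξ i) := by
    rw [intervalIntegral.integral_const, Complex.coe_smul]
  rw [e1, ← intervalIntegral.integral_sub (by simp) (hf.intervalIntegrable _ _)]
  have := intervalIntegral.norm_integral_le_of_norm_le_const
    (a := t i) (b := t (i + 1)) (C := ε) (f := fun s => f (ξ i) - f s) ?_
  · rwa [abs_of_nonneg (sub_nonneg.2 hle)] at this
  · intro s hs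
    rw [uIoc_of_le hle] at hs
    have m1 := hmono i hi.le
    have m2 := hmono (i + 1) hi
    rw [h0, hn] at m1 m2
    rw [← dist_eq_norm]
    refine (H _ ⟨m1.1.trans h1, h2.trans m2.2⟩ _ ⟨m1.1.trans hs.1.le, hs.2.trans m2.2⟩ ?_).le
    rw [Real.dist_eq, abs_lt]
    constructor <;> linarith [hs.1, hs.2]

theorem hasRiemannIntegral_of_continuous {f : ℝ → E} (hf : Continuous f) {a b : ℝ}
    (hab : a ≤ b) : HasRiemannIntegral f a b (∫ s in a..b, f s) := by
  intro U hU
  obtain ⟨ε, hε, hU⟩ := Metric.mem_nhds_iff.1 hU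
  have hpos : 0 < b - a + 1 := by linarith
  obtain ⟨δ, hδ, H⟩ := exists_norm_riemannSum_sub_integral_le hf a b (div_pos hε hpos)
  refine ⟨δ, hδ, fun n t ξ h0 hn h => hU ?_⟩
  rw [mem_ball_iff_norm]
  refine (H n t ξ h0 hn h).trans_lt ?_
  rw [div_mul_eq_mul_div, div_lt_iff₀ hpos]
  nlinarith

end Banach

/-! ### Reduction of locally convex spaces to Banach spaces, one seminorm at a time. -/

section Normed

universe u

/-- `E` is the Hausdorff completion of `Y` for the single seminorm `q`, so the kernel of `q` is
collapsed. -/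
theorem exists_normed_of_seminorm {Y : Type u} [AddCommGroup Y] [Module ℂ Y] (q : Seminorm ℂ Y) :
    ∃ (E : Type u) (_ : NormedAddCommGroup E) (_ : NormedSpace ℂ E) (_ : CompleteSpace E)
      (π : Y →ₗ[ℂ] E), ∀ y, ‖π y‖ = q y := by
  let _ : SeminormedAddCommGroup Y := q.toAddGroupSeminorm.toSeminormedAddCommGroup
  let _ : NormedSpace ℂ Y := ⟨fun c y => (map_smul_eq_mul q c y).le⟩
  refine ⟨UniformSpace.Completion Y, inferInstance, inferInstance, inferInstance,
    (UniformSpace.Completion.toComplₗᵢ (𝕜 := ℂ) (E := Y)).toLinearMap, fun y => ?_⟩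
  exact (UniformSpace.Completion.toComplₗᵢ (𝕜 := ℂ) (E := Y)).norm_map y

variable {Y : Type*} [AddCommGroup Y] [Module ℂ Y] [TopologicalSpace Y] [IsTopologicalAddGroup Y]
  [ContinuousSMul ℂ Y]

theorem exists_banach_of_seminorm {Y : Type u} [AddCommGroup Y] [Module ℂ Y] [TopologicalSpace Y]
    [IsTopologicalAddGroup Y] (q : Seminorm ℂ Y) (hq : Continuous q) :
    ∃ (E : Type u) (_ : NormedAddCommGroup E) (_ : NormedSpace ℂ E) (_ : CompleteSpace E)
      (π : Y →L[ℂ] E), ∀ y, ‖π y‖ = q y := by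
  obtain ⟨E, i1, i2, i3, π, hπ⟩ := exists_normed_of_seminorm q
  refine ⟨E, i1, i2, i3, ⟨π, ?_⟩, hπ⟩
  refine continuous_of_continuousAt_zero π.toAddMonoidHom ?_
  change Tendsto π (𝓝 0) (𝓝 (π 0))
  rw [map_zero, tendsto_zero_iff_norm_tendsto_zero]
  simp only [hπ]
  simpa using hq.tendsto 0

-- In the order of `ℂ` the nonnegative scalars are the nonnegative reals, so convexity over `ℂ` and
-- over `ℝ` agree. This gives access to gauge seminorms over `ℂ`.
open scoped ComplexOrder in
theorem LocallyConvexSpace.complex (Y : Type*) [AddCommGroup Y] [Module ℂ Y] [TopologicalSpace Y]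
    [LocallyConvexSpace ℝ Y] : LocallyConvexSpace ℂ Y where
  convex_basis x := (LocallyConvexSpace.convex_basis (𝕜 := ℝ) x).to_hasBasis
    (fun s hs => ⟨s, ⟨hs.1, convex_of_nonneg_surjective_algebraMap _
      (fun z hz => ⟨z.re, (Complex.nonneg_iff.1 hz).1,
        Complex.ext rfl (Complex.nonneg_iff.1 hz).2⟩) hs.2⟩, le_rfl⟩)
    fun s hs => ⟨s, ⟨hs.1, hs.2.lift ℝ⟩, le_rfl⟩

open scoped ComplexOrder in
theorem exists_seminorm_ball_subset [LocallyConvexSpace ℝ Y] {U : Set Y} (hU : U ∈ 𝓝 (0 : Y)) :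
    ∃ q : Seminorm ℂ Y, Continuous q ∧ ∀ y, q y < 1 → y ∈ U := by
  have : ContinuousSMul ℝ Y := IsScalarTower.continuousSMul ℂ
  have := LocallyConvexSpace.complex Y
  obtain ⟨s, ⟨h0, ho, hc⟩, hs⟩ := (nhds_hasBasis_absConvex_open ℂ Y).mem_iff.1 hU
  let s' : AbsConvexOpenSets ℂ Y := ⟨s, h0, ho, hc⟩
  refine ⟨gaugeSeminormFamily ℂ Y s', (with_gaugeSeminormFamily (𝕜 := ℂ)).continuous_seminorm s',
    fun y hy => hs ?_⟩
  have : y ∈ (gaugeSeminormFamily ℂ Y s').ball 0 1 := by simpa [Seminorm.mem_ball] using hy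
  rwa [gaugeSeminormFamily_ball] at this

variable [LocallyConvexSpace ℝ Y]

theorem tendsto_of_forall_seminorm {α : Type*} {l : Filter α} {f : α → Y} {y : Y}
    (h : ∀ q : Seminorm ℂ Y, Continuous q → Tendsto (fun i => q (f i - y)) l (𝓝 0)) :
    Tendsto f l (𝓝 y) := by
  rw [← tendsto_sub_nhds_zero_iff]
  intro U hU
  obtain ⟨q, hq, hqU⟩ := exists_seminorm_ball_subset hU
  exact ((h q hq).eventually (gt_mem_nhds zero_lt_one)).mono fun i hi => hqU _ hi

variable {Y : Type u} [AddCommGroup Y] [Module ℂ Y] [TopologicalSpace Y] [IsTopologicalAddGroup Y]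
  [ContinuousSMul ℂ Y]

/-- `y` is the integral of `f` over `[a, b]` after composition with any continuous linear map into a
Banach space. -/
def HasBanachIntegral (f : ℝ → Y) (a b : ℝ) (y : Y) : Prop :=
  ∀ (E : Type u) [NormedAddCommGroup E] [NormedSpace ℂ E] [CompleteSpace E] (π : Y →L[ℂ] E),
    π y = ∫ s in a..b, π (f s)

variable [LocallyConvexSpace ℝ Y]

theorem tendsto_of_forall_banach {α : Type*} {l : Filter α} {f : α → Y} {y : Y}
    (h : ∀ (E : Type u) [NormedAddCommGroup E] [NormedSpace ℂ E] [CompleteSpace E] (π : Y →L[ℂ] E),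
      Tendsto (fun i => π (f i)) l (𝓝 (π y))) :
    Tendsto f l (𝓝 y) := by
  refine tendsto_of_forall_seminorm fun q hq => ?_
  obtain ⟨E, _, _, _, π, hπ⟩ := exists_banach_of_seminorm q hq
  simpa only [← hπ, map_sub] using tendsto_iff_norm_sub_tendsto_zero.1 (h E π)

theorem eq_of_forall_banach [T2Space Y] {x y : Y}
    (h : ∀ (E : Type u) [NormedAddCommGroup E] [NormedSpace ℂ E] [CompleteSpace E] (π : Y →L[ℂ] E),
      π x = π y) : x = y := by
  have : Tendsto (fun _ : ℕ => x) atTop (𝓝 y) :=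
    tendsto_of_forall_banach fun E _ _ _ π => by simp [h E π]
  exact tendsto_nhds_unique tendsto_const_nhds this

theorem HasBanachIntegral.unique [T2Space Y] {f : ℝ → Y} {a b : ℝ} {y y' : Y}
    (h : HasBanachIntegral f a b y) (h' : HasBanachIntegral f a b y') : y = y' :=
  eq_of_forall_banach fun E _ _ _ π => (h E π).trans (h' E π).symm

/-- A given neighbourhood is controlled by one continuous seminorm, so the estimate in one Banach
space suffices. -/
theorem HasBanachIntegral.hasRiemannIntegral {f : ℝ → Y} (hf : Continuous f) {a b : ℝ}
    (hab : a ≤ b) {y : Y} (h : HasBanachIntegral f a b y) : HasRiemannIntegral f a b y := by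
  intro U hU
  obtain ⟨q, hq, hqU⟩ := exists_seminorm_ball_subset
    (show (fun z => y + z) ⁻¹' U ∈ 𝓝 0 from
      (continuous_const_add y).continuousAt.preimage_mem_nhds (by simpa using hU))
  obtain ⟨E, _, _, _, π, hπ⟩ := exists_banach_of_seminorm q hq
  obtain ⟨δ, hδ, H⟩ := hasRiemannIntegral_of_continuous (π.continuous.comp hf) hab _
    (Metric.ball_mem_nhds _ one_pos)
  refine ⟨δ, hδ, fun n t ξ h0 hn ht => ?_⟩
  have := H n t ξ h0 hn ht
  rw [mem_ball_iff_norm] at this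
  have e := hqU (∑ i ∈ Finset.range n, ((t (i + 1) - t i : ℝ) : ℂ) • f (ξ i) - y) ?_
  · simpa using e
  · rw [← hπ, map_sub, map_sum, h E π]
    simpa only [map_smul, Function.comp_apply] using this

end Normed

/-! ### Existence of integrals under sequential completeness. -/

section LeftSums

variable {Y : Type*} [AddCommGroup Y] [Module ℂ Y] [TopologicalSpace Y]

/-- The left Riemann sums over equidistant partitions. -/
def leftRiemannSum {Y : Type*} [AddCommGroup Y] [Module ℂ Y] (f : ℝ → Y) (a b : ℝ) (N : ℕ) : Y :=
  ∑ i ∈ Finset.range (N + 1), (((b - a) / (N + 1) : ℝ) : ℂ) • f (a + i * ((b - a) / (N + 1)))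

theorem HasRiemannIntegral.tendsto_leftRiemannSum {f : ℝ → Y} {a b : ℝ} (hab : a ≤ b) {y : Y}
    (h : HasRiemannIntegral f a b y) : Tendsto (leftRiemannSum f a b) atTop (𝓝 y) := by
  intro U hU
  obtain ⟨δ, hδ, H⟩ := h U hU
  have ht : Tendsto (fun N : ℕ => (b - a) / ((N : ℝ) + 1)) atTop (𝓝 0) :=
    tendsto_const_nhds.div_atTop (tendsto_natCast_atTop_atTop.atTop_add tendsto_const_nhds)
  change ∀ᶠ N in atTop, leftRiemannSum f a b N ∈ U
  filter_upwards [ht.eventually (gt_mem_nhds hδ)] with N hN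
  have hpos : (0 : ℝ) < N + 1 := by positivity
  have hstep : 0 ≤ (b - a) / ((N : ℝ) + 1) := div_nonneg (by linarith) hpos.le
  have hdiff : ∀ i : ℕ, a + ((i + 1 : ℕ) : ℝ) * ((b - a) / (N + 1)) -
      (a + i * ((b - a) / (N + 1))) = (b - a) / (N + 1) := fun i => by push_cast; ring
  have := H (N + 1) (fun i => a + i * ((b - a) / (N + 1))) (fun i => a + i * ((b - a) / (N + 1)))
    (by simp) (by push_cast; field_simp; ring) fun i _ =>
      ⟨le_rfl, by linarith [hdiff i], by rw [hdiff]; exact hN⟩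
  simp only [hdiff] at this
  exact this

theorem map_leftRiemannSum {Z : Type*} [AddCommGroup Z] [Module ℂ Z] [TopologicalSpace Z]
    (π : Y →L[ℂ] Z) (f : ℝ → Y) (a b : ℝ) (N : ℕ) :
    π (leftRiemannSum f a b N) = leftRiemannSum (fun s => π (f s)) a b N := by
  simp [leftRiemannSum]

end LeftSums

section SeqComplete

variable {Y : Type*} [AddCommGroup Y] [Module ℂ Y] [UniformSpace Y] [IsUniformAddGroup Y]
  [ContinuousSMul ℂ Y] [LocallyConvexSpace ℝ Y]

/-- A sequence of Riemann sums suffices: it is Cauchy for every continuous seminorm, since its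
images in Banach spaces converge. -/
theorem SeqComplete.exists_hasBanachIntegral (hY : SeqComplete Y) {f : ℝ → Y} (hf : Continuous f)
    {a b : ℝ} (hab : a ≤ b) : ∃ y, HasBanachIntegral f a b y := by
  have hlim : ∀ (E : Type _) [NormedAddCommGroup E] [NormedSpace ℂ E] [CompleteSpace E]
      (π : Y →L[ℂ] E), Tendsto (fun N => π (leftRiemannSum f a b N)) atTop
        (𝓝 (∫ s in a..b, π (f s))) := by
    intro E _ _ _ π
    simp only [map_leftRiemannSum]
    exact (hasRiemannIntegral_of_continuous (π.continuous.comp hf) hab).tendsto_leftRiemannSum hab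
  have hc : CauchySeq (leftRiemannSum f a b) := by
    rw [cauchySeq_iff_tendsto, uniformity_eq_comap_nhds_zero, tendsto_comap_iff]
    refine tendsto_of_forall_seminorm fun q hq => ?_
    obtain ⟨E, _, _, _, π, hπ⟩ := exists_banach_of_seminorm q hq
    have := (cauchySeq_iff_tendsto.1 (hlim E π).cauchySeq)
    rw [uniformity_eq_comap_nhds_zero, tendsto_comap_iff] at this
    simpa [← hπ, Function.comp_def] using this.norm
  obtain ⟨y, hy⟩ := hY _ hc
  exact ⟨y, fun E _ _ _ π => tendsto_nhds_unique ((π.continuous.tendsto y).comp hy) (hlim E π)⟩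

end SeqComplete

theorem HasRiemannIntegral.map {Y Z : Type*} [AddCommGroup Y] [Module ℂ Y] [TopologicalSpace Y]
    [AddCommGroup Z] [Module ℂ Z] [TopologicalSpace Z] (L : Y →L[ℂ] Z) {f : ℝ → Y} {a b : ℝ}
    {y : Y} (h : HasRiemannIntegral f a b y) :
    HasRiemannIntegral (fun s => L (f s)) a b (L y) := by
  intro U hU
  obtain ⟨δ, hδ, H⟩ := h _ (L.continuous.continuousAt.preimage_mem_nhds hU)
  refine ⟨δ, hδ, fun n t ξ h0 hn ht => ?_⟩
  simpa using H n t ξ h0 hn ht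

/-! ### Calculus of the integral tested in Banach spaces. -/

section BanachIntegral

universe u

variable {Y : Type u} [AddCommGroup Y] [Module ℂ Y] [TopologicalSpace Y]

theorem HasBanachIntegral.add {f g : ℝ → Y} (hf : Continuous f) (hg : Continuous g)
    {a b : ℝ} {y z : Y} (h : HasBanachIntegral f a b y) (h' : HasBanachIntegral g a b z) :
    HasBanachIntegral (fun s => f s + g s) a b (y + z) := by
  intro E _ _ _ π
  simp only [map_add, h E π, h' E π]
  exact (intervalIntegral.integral_add ((π.continuous.comp hf).intervalIntegrable _ _)
    ((π.continuous.comp hg).intervalIntegrable _ _)).symm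

theorem HasBanachIntegral.smul {f : ℝ → Y} {a b : ℝ} {y : Y} (c : ℂ)
    (h : HasBanachIntegral f a b y) : HasBanachIntegral (fun s => c • f s) a b (c • y) := by
  intro E _ _ _ π
  simp only [map_smul, h E π, intervalIntegral.integral_smul]

theorem HasBanachIntegral.congr {f g : ℝ → Y} {a b : ℝ} (hab : a ≤ b) {y : Y}
    (h : HasBanachIntegral f a b y) (hfg : ∀ s ∈ Icc a b, f s = g s) :
    HasBanachIntegral g a b y := by
  intro E _ _ _ π
  rw [h E π]
  refine intervalIntegral.integral_congr fun s hs => ?_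
  rw [uIcc_of_le hab] at hs
  simp only [hfg s hs]

theorem HasBanachIntegral.map {Z : Type u} [AddCommGroup Z] [Module ℂ Z] [TopologicalSpace Z]
    (L : Y →L[ℂ] Z) {f : ℝ → Y} {a b : ℝ} {y : Y} (h : HasBanachIntegral f a b y) :
    HasBanachIntegral (fun s => L (f s)) a b (L y) :=
  fun E _ _ _ π => h E (π.comp L)

theorem HasBanachIntegral.seminorm_le [IsTopologicalAddGroup Y] {f : ℝ → Y} {a b : ℝ}
    (hab : a ≤ b) {y : Y}
    (h : HasBanachIntegral f a b y) {q : Seminorm ℂ Y} (hq : Continuous q) {C : ℝ}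
    (hC : ∀ s ∈ Icc a b, q (f s) ≤ C) : q y ≤ C * (b - a) := by
  obtain ⟨E, _, _, _, π, hπ⟩ := exists_banach_of_seminorm q hq
  rw [← hπ, h E π, ← abs_of_nonneg (sub_nonneg.2 hab)]
  refine intervalIntegral.norm_integral_le_of_norm_le_const fun s hs => ?_
  rw [uIoc_of_le hab] at hs
  rw [hπ]
  exact hC s ⟨hs.1.le, hs.2⟩

end BanachIntegral

theorem continuous_of_seminorm_le {Y Z : Type*} [AddCommGroup Y] [Module ℂ Y] [TopologicalSpace Y]
    [IsTopologicalAddGroup Y] [AddCommGroup Z] [Module ℂ Z] [TopologicalSpace Z]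
    [IsTopologicalAddGroup Z] [ContinuousSMul ℂ Z] [LocallyConvexSpace ℝ Z] (L : Y →ₗ[ℂ] Z)
    (h : ∀ q : Seminorm ℂ Z, Continuous q →
      ∃ p : Seminorm ℂ Y, Continuous p ∧ ∃ C : ℝ, ∀ y, q (L y) ≤ C * p y) : Continuous L := by
  refine continuous_of_continuousAt_zero L.toAddMonoidHom ?_
  change Tendsto L (𝓝 0) (𝓝 (L 0))
  rw [map_zero]
  refine tendsto_of_forall_seminorm fun q hq => ?_
  obtain ⟨p, hp, C, hC⟩ := h q hq
  have h0 : Tendsto (fun y => C * p y) (𝓝 0) (𝓝 0) := by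
    simpa using (hp.tendsto 0).const_mul C
  exact squeeze_zero (fun _ => apply_nonneg _ _) (fun y => by simpa using hC y) h0

/-! ### The operator-valued orbit integral. -/

section Semigroup

variable {X : Type*} [AddCommGroup X] [Module ℂ X]

theorem continuous_orbit [TopologicalSpace X] {T : ℝ≥0 → X →L[ℂ] X} (hcont : IsStronglyContinuous T)
    (x : X) : Continuous fun s : ℝ => T s.toNNReal x :=
  (hcont x).comp continuous_real_toNNReal

theorem continuous_weighted_orbit [TopologicalSpace X] [ContinuousSMul ℂ X] {T : ℝ≥0 → X →L[ℂ] X}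
    (hcont : IsStronglyContinuous T) {ρ : ℝ≥0} (φ : C(Icc (0 : ℝ) ρ, ℂ)) (x : X) :
    Continuous fun s : ℝ => IccExtend ρ.coe_nonneg φ s • T s.toNNReal x :=
  (φ.continuous.Icc_extend').smul (continuous_orbit hcont x)

/-- `I φ x` is the integral of `φ s • T s x` over `[0, ρ]`. -/
def IsOrbitIntegral [UniformSpace X] [IsUniformAddGroup X] [ContinuousSMul ℂ X]
    (T : ℝ≥0 → X →L[ℂ] X) (ρ : ℝ≥0) (I : C(Icc (0 : ℝ) ρ, ℂ) →L[ℂ] X →L[ℂ] X) : Prop :=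
  ∀ (φ : C(Icc (0 : ℝ) ρ, ℂ)) (x : X),
    HasBanachIntegral (fun s : ℝ => IccExtend ρ.coe_nonneg φ s • T s.toNNReal x) 0 ρ (I φ x)

/-- The bound is uniform in both `φ` and `x`: it serves the continuity of each `I φ`, the continuity
of `I`, and later the equicontinuity of resolvents. -/
theorem exists_seminorm_bound_of_hasBanachIntegral [UniformSpace X]
    [IsUniformAddGroup X] {T : ℝ≥0 → X →L[ℂ] X}
    (hequi : IsLocallyEquicontinuous T) {ρ : ℝ≥0} {J : C(Icc (0 : ℝ) ρ, ℂ) → X → X}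
    (hJ : ∀ (φ : C(Icc (0 : ℝ) ρ, ℂ)) (x : X),
      HasBanachIntegral (fun s : ℝ => IccExtend ρ.coe_nonneg φ s • T s.toNNReal x) 0 ρ (J φ x))
    (q : Seminorm ℂ X) (hq : Continuous q) :
    ∃ p : Seminorm ℂ X, Continuous p ∧ ∃ C : ℝ, 0 ≤ C ∧
      ∀ φ x, q (J φ x) ≤ C * ‖φ‖ * p x := by
  obtain ⟨p, hp, C, hC0, hC⟩ := hequi q hq ρ
  refine ⟨p, hp, C * ρ, by positivity, fun φ x => ?_⟩
  have := (hJ φ x).seminorm_le ρ.coe_nonneg hq (C := ‖φ‖ * (C * p x)) fun s hs => by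
    rw [map_smul_eq_mul]
    refine mul_le_mul ?_ (hC _ (Real.toNNReal_le_iff_le_coe.2 hs.2) x) (apply_nonneg _ _)
      (norm_nonneg _)
    rw [IccExtend_of_mem _ _ hs]
    exact φ.norm_coe_le_norm _
  refine this.trans (le_of_eq ?_)
  rw [sub_zero]
  ring

variable [UniformSpace X] [IsUniformAddGroup X] [ContinuousSMul ℂ X] [LocallyConvexSpace ℝ X]

/-- Linearity in `φ` and in `x` follows from uniqueness of integrals, continuity from the seminorm
bound. -/
theorem exists_isOrbitIntegral [T2Space X] (hX : SeqComplete X) {T : ℝ≥0 → X →L[ℂ] X}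
    (hcont : IsStronglyContinuous T) (hequi : IsLocallyEquicontinuous T) (ρ : ℝ≥0) :
    ∃ I : C(Icc (0 : ℝ) ρ, ℂ) →L[ℂ] X →L[ℂ] X, IsOrbitIntegral T ρ I := by
  choose J hJ using fun (φ : C(Icc (0 : ℝ) ρ, ℂ)) (x : X) =>
    hX.exists_hasBanachIntegral (continuous_weighted_orbit hcont φ x) ρ.coe_nonneg
  have hbound := exists_seminorm_bound_of_hasBanachIntegral hequi hJ
  have hlin : ∀ φ, ∃ L : X →L[ℂ] X, ∀ x, L x = J φ x := by
    intro φ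
    let L : X →ₗ[ℂ] X :=
      { toFun := J φ
        map_add' := fun x y => (hJ φ (x + y)).unique <|
          ((hJ φ x).add (continuous_weighted_orbit hcont φ x) (continuous_weighted_orbit hcont φ y)
            (hJ φ y)).congr ρ.coe_nonneg fun s _ => by rw [map_add, smul_add]
        map_smul' := fun c x => (hJ φ (c • x)).unique <|
          ((hJ φ x).smul c).congr ρ.coe_nonneg fun s _ => by rw [map_smul, smul_comm] }
    refine ⟨⟨L, continuous_of_seminorm_le L fun q hq => ?_⟩, fun x => rfl⟩
    obtain ⟨p, hp, C, -, hC⟩ := hbound q hq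
    exact ⟨p, hp, C * ‖φ‖, hC φ⟩
  choose L hL using hlin
  let I : C(Icc (0 : ℝ) ρ, ℂ) →ₗ[ℂ] X →L[ℂ] X :=
    { toFun := L
      map_add' := fun φ ψ => by
        ext x
        rw [add_apply, hL, hL, hL]
        exact (hJ (φ + ψ) x).unique <| ((hJ φ x).add (continuous_weighted_orbit hcont φ x)
          (continuous_weighted_orbit hcont ψ x) (hJ ψ x)).congr ρ.coe_nonneg fun s _ => by
            rw [← add_smul]; rfl
      map_smul' := fun c φ => by
        ext x
        rw [RingHom.id_apply, smul_apply, hL, hL]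
        exact (hJ (c • φ) x).unique <| ((hJ φ x).smul c).congr ρ.coe_nonneg fun s _ => by
            rw [smul_smul]; rfl }
  suffices hI : Continuous I from ⟨⟨I, hI⟩, fun φ x => (hL φ x).symm ▸ hJ φ x⟩
  refine continuous_of_continuousAt_zero I.toAddMonoidHom ?_
  change Tendsto I (𝓝 0) (𝓝 (I 0))
  rw [map_zero, ContinuousLinearMap.hasBasis_nhds_zero.tendsto_right_iff]
  rintro ⟨S, V⟩ ⟨hS, hV⟩
  obtain ⟨q, hq, hqV⟩ := exists_seminorm_ball_subset hV
  obtain ⟨p, hp, C, hC0, hC⟩ := hbound q hq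
  -- The unit ball of `p` absorbs the bounded set `S`, so `p` is bounded on `S`; this gives
  -- convergence uniformly on `S`.
  obtain ⟨M, hM0, hM⟩ : ∃ M : ℝ, 0 ≤ M ∧ ∀ x ∈ S, p x ≤ M := by
    have hp0 : {x | p x < 1} ∈ 𝓝 (0 : X) :=
      (hp.tendsto 0).eventually (gt_mem_nhds (by simp))
    obtain ⟨M, hM0, hM⟩ := (hS hp0).exists_pos
    refine ⟨M, hM0.le, fun x hx => ?_⟩
    obtain ⟨v, hv, rfl⟩ := hM (M : ℂ) (by simp [abs_of_pos hM0]) hx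
    change p ((M : ℂ) • v) ≤ M
    rw [map_smul_eq_mul, Complex.norm_real, Real.norm_of_nonneg hM0.le]
    exact mul_le_of_le_one_right hM0.le (le_of_lt hv)
  have h0 : Tendsto (fun φ : C(Icc (0 : ℝ) ρ, ℂ) => C * ‖φ‖ * M) (𝓝 0) (𝓝 0) := by
    simpa using ((continuous_norm.tendsto (0 : C(Icc (0 : ℝ) ρ, ℂ))).const_mul C).mul_const M
  filter_upwards [h0.eventually (gt_mem_nhds one_pos)] with φ hφ x hx
  refine hqV _ ?_
  change q (L φ x) < 1
  rw [hL]
  exact (hC φ x).trans_lt ((mul_le_mul_of_nonneg_left (hM x hx) (by positivity)).trans_lt hφ)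

end Semigroup

/-! ### Exponentials and the zeros of `1 - exp(-μρ)`. -/

/-- The function `s ↦ exp (-μ s)` on `[0, ρ]`. -/
def expFun (ρ : ℝ≥0) (μ : ℂ) : C(Icc (0 : ℝ) ρ, ℂ) :=
  ⟨fun s => Complex.exp (-μ * (s : ℝ)), by fun_prop⟩

/-- Writing `expFun` as an exponential in the Banach algebra `C([0,ρ], ℂ)` makes it holomorphic in
the supremum norm. -/
theorem expFun_eq_exp (ρ : ℝ≥0) (μ : ℂ) :
    expFun ρ μ = NormedSpace.exp (μ • (⟨fun s => -((s : ℝ) : ℂ), by fun_prop⟩ :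
      C(Icc (0 : ℝ) ρ, ℂ))) := by
  ext s
  have := NormedSpace.map_exp (ContinuousMap.evalAlgHom ℂ ℂ s)
    (continuous_eval_const s)
    (μ • (⟨fun s => -((s : ℝ) : ℂ), by fun_prop⟩ : C(Icc (0 : ℝ) ρ, ℂ)))
  change (expFun ρ μ) s = ContinuousMap.evalAlgHom ℂ ℂ s _
  rw [this, ← Complex.exp_eq_exp_ℂ]
  simp [expFun]

theorem differentiable_expFun (ρ : ℝ≥0) : Differentiable ℂ (expFun ρ) := by
  rw [funext (expFun_eq_exp ρ)]
  exact fun μ => (hasDerivAt_exp_smul_const (𝕂 := ℂ) (𝔸 := C(Icc (0 : ℝ) ρ, ℂ)) _ μ).differentiableAt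

/-- The function `μ ↦ 1 - exp (-μ ρ)`, whose zeros are the points of `lattice ρ`. -/
def expDefect (ρ : ℝ≥0) (μ : ℂ) : ℂ := 1 - Complex.exp (-μ * (ρ : ℝ))

theorem hasDerivAt_expDefect (ρ : ℝ≥0) (μ : ℂ) :
    HasDerivAt (expDefect ρ) ((ρ : ℝ) * Complex.exp (-μ * (ρ : ℝ))) μ := by
  have := (((hasDerivAt_id μ).neg.mul_const ((ρ : ℝ) : ℂ)).cexp).const_sub 1
  convert! this using 1
  simp [mul_comm]

theorem differentiable_expDefect (ρ : ℝ≥0) : Differentiable ℂ (expDefect ρ) :=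
  fun μ => (hasDerivAt_expDefect ρ μ).differentiableAt

theorem expDefect_eq_zero_iff {ρ : ℝ≥0} (hρ : 0 < ρ) {μ : ℂ} :
    expDefect ρ μ = 0 ↔ μ ∈ lattice ρ := by
  have hρ' : ((ρ : ℝ) : ℂ) ≠ 0 := by exact_mod_cast hρ.ne'
  rw [expDefect, sub_eq_zero, eq_comm, Complex.exp_eq_one_iff]
  constructor
  · rintro ⟨n, hn⟩
    refine ⟨-n, ?_⟩
    rw [latticePoint, div_eq_iff hρ']
    push_cast
    linear_combination hn
  · rintro ⟨n, rfl⟩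
    refine ⟨-n, ?_⟩
    rw [latticePoint]
    push_cast
    field_simp

theorem expDefect_latticePoint {ρ : ℝ≥0} (hρ : 0 < ρ) (n : ℤ) :
    expDefect ρ (latticePoint ρ n) = 0 :=
  (expDefect_eq_zero_iff hρ).2 ⟨n, rfl⟩

theorem hasDerivAt_expDefect_latticePoint {ρ : ℝ≥0} (hρ : 0 < ρ) (n : ℤ) :
    HasDerivAt (expDefect ρ) ((ρ : ℝ) : ℂ) (latticePoint ρ n) := by
  have h := hasDerivAt_expDefect ρ (latticePoint ρ n)
  rwa [← sub_eq_zero.1 (expDefect_latticePoint hρ n), mul_one] at h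

/-- Translation by `h` turns the integral into `exp(μh) (V(h + r) - V(h))`, with `V` a primitive of
`exp(-μs) u(s)`; the product rule then applies although `u` is only continuous. -/
theorem hasDerivAt_exp_smul_integral {E : Type*} [NormedAddCommGroup E] [NormedSpace ℂ E]
    [CompleteSpace E] {u : ℝ → E} (hu : Continuous u) (μ : ℂ) (r : ℝ) :
    HasDerivAt (fun h : ℝ => ∫ s in (0 : ℝ)..r, Complex.exp (-μ * s) • u (s + h))
      (μ • (∫ s in (0 : ℝ)..r, Complex.exp (-μ * s) • u s) +
        (Complex.exp (-μ * r) • u r - u 0)) 0 := by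
  let v : ℝ → E := fun s => Complex.exp (-μ * s) • u s
  have hv : Continuous v := by fun_prop
  have hV : ∀ t, HasDerivAt (fun t => ∫ s in (0 : ℝ)..t, v s) (v t) t := fun t =>
    intervalIntegral.integral_hasDerivAt_right (hv.intervalIntegrable _ _)
      hv.aestronglyMeasurable.stronglyMeasurableAtFilter hv.continuousAt
  have heq : (fun h : ℝ => ∫ s in (0 : ℝ)..r, Complex.exp (-μ * s) • u (s + h)) =
      fun h : ℝ => Complex.exp (μ * h) • ((∫ s in (0 : ℝ)..h + r, v s) - ∫ s in (0 : ℝ)..h, v s) := by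
    ext h
    rw [intervalIntegral.integral_interval_sub_left (hv.intervalIntegrable _ _)
      (hv.intervalIntegrable _ _), ← intervalIntegral.integral_smul]
    have := intervalIntegral.integral_comp_add_right (a := 0) (b := r)
      (fun s => Complex.exp (μ * h) • v s) h
    rw [zero_add, add_comm r h] at this
    rw [← this]
    refine intervalIntegral.integral_congr fun s _ => ?_
    simp only [v, smul_smul, ← Complex.exp_add]
    congr 2
    push_cast
    ring
  rw [heq]
  have h1 : HasDerivAt (fun h : ℝ => Complex.exp (μ * h)) μ 0 := by
    have := (((hasDerivAt_id (0 : ℝ)).ofReal_comp).const_mul μ).cexp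
    simpa using this
  have h2 : HasDerivAt (fun h : ℝ => ∫ s in (0 : ℝ)..h + r, v s) (v r) 0 := by
    have := HasDerivAt.comp_add_const (0 : ℝ) r (by simpa using hV r)
    exact this
  convert! h1.smul (h2.sub (hV 0)) using 1
  simp [v, add_comm]

/-! ### The orbit integral of a periodic semigroup and the generator. -/

section

variable {X : Type*} [AddCommGroup X] [Module ℂ X]

/-- Strong continuity makes the set where `T t = id` closed, so it contains the infimum. -/
theorem map_period_eq_id [TopologicalSpace X] [T2Space X] {T : ℝ≥0 → X →L[ℂ] X} {ρ : ℝ≥0}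
    (hcont : IsStronglyContinuous T) (hper : IsPeriodic T)
    (hρ : period T = ρ) : T ρ = ContinuousLinearMap.id ℂ X := by
  have hc : IsClosed {t : ℝ≥0 | T t = ContinuousLinearMap.id ℂ X} := by
    have : {t : ℝ≥0 | T t = ContinuousLinearMap.id ℂ X} = ⋂ x : X, {t | T t x = x} := by
      ext t
      simp [ContinuousLinearMap.ext_iff]
    rw [this]
    exact isClosed_iInter fun x => isClosed_eq (hcont x) continuous_const
  have hmem := csInf_mem_closure (s := {t : ℝ≥0 | 0 < t ∧ T t = ContinuousLinearMap.id ℂ X})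
    hper (OrderBot.bddBelow _)
  have := hc.closure_subset_iff.2 (fun t ht => ht.2) hmem
  rwa [← hρ]

variable [UniformSpace X] [IsUniformAddGroup X]
  [ContinuousSMul ℂ X] {T : ℝ≥0 → X →L[ℂ] X} {ρ : ℝ≥0}
  {I : C(Icc (0 : ℝ) ρ, ℂ) →L[ℂ] X →L[ℂ] X}

theorem IsOrbitIntegral.expFun (hI : IsOrbitIntegral T ρ I) (μ : ℂ) (x : X) :
    HasBanachIntegral (fun s : ℝ => Complex.exp (-μ * s) • T s.toNNReal x) 0 ρ
      (I (expFun ρ μ) x) :=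
  (hI (LCSemigroup.expFun ρ μ) x).congr ρ.coe_nonneg fun s hs => by
    rw [IccExtend_of_mem _ _ hs]; rfl

theorem IsOrbitIntegral.hasRiemannIntegral [LocallyConvexSpace ℝ X]
    (hI : IsOrbitIntegral T ρ I) (hcont : IsStronglyContinuous T) (μ : ℂ) (x : X) :
    HasRiemannIntegral (fun s : ℝ => Complex.exp (-μ * s) • T s.toNNReal x) 0 ρ
      (I (LCSemigroup.expFun ρ μ) x) := by
  refine (hI.expFun μ x).hasRiemannIntegral ?_ ρ.coe_nonneg
  exact Continuous.smul (by fun_prop) (continuous_orbit hcont x)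

theorem IsOrbitIntegral.map_comm [LocallyConvexSpace ℝ X] [T2Space X]
    (hI : IsOrbitIntegral T ρ I) {V : X →L[ℂ] X} (hV : ∀ t x, V (T t x) = T t (V x))
    (φ : C(Icc (0 : ℝ) ρ, ℂ)) (x : X) : V (I φ x) = I φ (V x) := by
  refine ((hI φ x).map V).unique ?_
  simpa only [map_smul, hV] using hI φ (V x)

theorem IsOrbitIntegral.semigroup_comm [LocallyConvexSpace ℝ X] [T2Space X]
    (hI : IsOrbitIntegral T ρ I) (hT : IsSemigroup T) (t : ℝ≥0)
    (φ : C(Icc (0 : ℝ) ρ, ℂ)) (x : X) : T t (I φ x) = I φ (T t x) :=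
  hI.map_comm (fun s x => by
    rw [← ContinuousLinearMap.comp_apply, ← hT.map_add, add_comm, hT.map_add]; rfl) φ x

theorem IsOrbitIntegral.integral_comm [LocallyConvexSpace ℝ X] [T2Space X]
    (hI : IsOrbitIntegral T ρ I) (hT : IsSemigroup T)
    (φ ψ : C(Icc (0 : ℝ) ρ, ℂ)) (x : X) : I φ (I ψ x) = I ψ (I φ x) :=
  hI.map_comm (fun t x => (hI.semigroup_comm hT t φ x).symm) ψ x

/-- This is `(μ - A) I(e_μ) = ω(μ)`: as `T ρ = id`, the boundary term `exp(-μρ) T(ρ)x - x` equals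
`-ω(μ) x`. -/
theorem IsOrbitIntegral.hasGeneratorValue [LocallyConvexSpace ℝ X]
    (hI : IsOrbitIntegral T ρ I) (hT : IsSemigroup T) (hcont : IsStronglyContinuous T)
    (hTρ : T ρ = ContinuousLinearMap.id ℂ X) (μ : ℂ) (x : X) :
    HasGeneratorValue T (I (LCSemigroup.expFun ρ μ) x)
      (μ • I (LCSemigroup.expFun ρ μ) x - expDefect ρ μ • x) := by
  refine tendsto_of_forall_banach fun E _ _ _ π => ?_
  set y := I (LCSemigroup.expFun ρ μ) x with hy
  -- On negative `s` the truncation gives the constant `π x`, so `u` is continuous on `ℝ` and `G`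
  -- has a two-sided derivative at `0`; only its right-hand limit is used.
  let u : ℝ → E := fun s => π (T s.toNNReal x)
  have hu : Continuous u := π.continuous.comp (continuous_orbit hcont x)
  let G : ℝ → E := fun h => ∫ s in (0 : ℝ)..ρ, Complex.exp (-μ * s) • u (s + h)
  have hG : ∀ t : ℝ≥0, π (T t y) = G t := by
    intro t
    have := hI.expFun μ x E (π.comp (T t))
    rw [ContinuousLinearMap.comp_apply, ← hy] at this
    rw [this]
    refine intervalIntegral.integral_congr fun s hs => ?_
    rw [uIcc_of_le ρ.coe_nonneg] at hs
    simp only [map_smul, u, ContinuousLinearMap.comp_apply]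
    rw [Real.toNNReal_add hs.1 t.coe_nonneg, Real.toNNReal_coe, add_comm, hT.map_add,
      ContinuousLinearMap.comp_apply]
  have hG0 : π y = G 0 := by
    have := hG 0
    rwa [hT.map_zero] at this
  have hder := hasDerivAt_exp_smul_integral hu μ ρ
  have hval : μ • (∫ s in (0 : ℝ)..ρ, Complex.exp (-μ * s) • u s) +
      (Complex.exp (-μ * (ρ : ℝ)) • u ρ - u 0) = π (μ • y - expDefect ρ μ • x) := by
    have e1 : (∫ s in (0 : ℝ)..ρ, Complex.exp (-μ * s) • u s) = π y := by
      rw [hG0]; simp [G]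
    have e2 : u ρ = π x := by simp [u, hTρ]
    have e3 : u 0 = π x := by simp [u, hT.map_zero]
    rw [e1, e2, e3, map_sub, map_smul, map_smul, expDefect]
    module
  rw [hval, hasDerivAt_iff_tendsto_slope] at hder
  have hcoe : Tendsto (fun t : ℝ≥0 => (t : ℝ)) (𝓝[>] 0) (𝓝[≠] 0) := by
    refine tendsto_nhdsWithin_iff.2 ⟨?_, ?_⟩
    · exact (NNReal.continuous_coe.tendsto 0).mono_left nhdsWithin_le_nhds
    · filter_upwards [self_mem_nhdsWithin] with t ht
      have : (0 : ℝ≥0) < t := ht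
      exact (NNReal.coe_pos.2 this).ne'
  refine (hder.comp hcoe).congr fun t => ?_
  rw [Function.comp_apply, slope_def_module, sub_zero, map_smul, map_sub, hG, hG0,
    ← Complex.ofReal_inv, Complex.coe_smul]

/-- `I(e_μ)` is continuous and commutes with every `T t`, so it maps the difference quotients of `x`
to those of `I(e_μ)x`. -/
theorem IsOrbitIntegral.map_generatorValue [LocallyConvexSpace ℝ X] [T2Space X]
    (hI : IsOrbitIntegral T ρ I) (hT : IsSemigroup T) (hcont : IsStronglyContinuous T)
    (hTρ : T ρ = ContinuousLinearMap.id ℂ X) (μ : ℂ) {x y : X} (h : HasGeneratorValue T x y) :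
    I (LCSemigroup.expFun ρ μ) y =
      μ • I (LCSemigroup.expFun ρ μ) x - expDefect ρ μ • x := by
  refine tendsto_nhds_unique ?_ (hI.hasGeneratorValue hT hcont hTρ μ x)
  have := ((I (LCSemigroup.expFun ρ μ)).continuous.tendsto y).comp h
  refine this.congr fun t => ?_
  rw [Function.comp_apply, map_smul, map_sub, hI.semigroup_comm hT]

end

/-! ### Locally uniform convergence and circle integrals under continuous linear maps. -/

theorem tendstoLocallyUniformlyOn_iff_tendsto_sub {G α ι : Type*} [AddCommGroup G] [UniformSpace G]
    [IsUniformAddGroup G] [TopologicalSpace α] {F : ι → α → G} {f : α → G} {l : Filter ι}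
    {s : Set α} :
    TendstoLocallyUniformlyOn F f l s ↔
      ∀ x ∈ s, Tendsto (fun y : ι × α => F y.1 y.2 - f y.2) (l ×ˢ 𝓝[s] x) (𝓝 0) := by
  rw [tendstoLocallyUniformlyOn_iff_forall_tendsto]
  simp only [uniformity_eq_comap_nhds_zero, tendsto_comap_iff, Function.comp_def]

theorem TendstoLocallyUniformlyOn.map_clm {Y Z α ι : Type*} [AddCommGroup Y] [Module ℂ Y]
    [UniformSpace Y] [IsUniformAddGroup Y] [AddCommGroup Z] [Module ℂ Z] [UniformSpace Z]
    [IsUniformAddGroup Z] [TopologicalSpace α] (L : Y →L[ℂ] Z) {F : ι → α → Y} {f : α → Y}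
    {l : Filter ι} {s : Set α} (h : TendstoLocallyUniformlyOn F f l s) :
    TendstoLocallyUniformlyOn (fun i x => L (F i x)) (fun x => L (f x)) l s := by
  rw [tendstoLocallyUniformlyOn_iff_tendsto_sub] at h ⊢
  intro x hx
  simpa [Function.comp_def] using (L.continuous.tendsto 0).comp (h x hx)

theorem sum_Icc_neg_one {G : Type*} [AddCommMonoid G] (g : ℤ → G) (N : ℕ) :
    ∑ k ∈ Finset.Icc (-1 : ℤ) N, g k = ∑ i ∈ Finset.range (N + 2), g (i - 1) := by
  refine Finset.sum_nbij' (fun k => (k + 1).toNat) (fun i => (i : ℤ) - 1) ?_ ?_ ?_ ?_ ?_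
  · intro k hk
    rw [Finset.mem_Icc] at hk
    rw [Finset.mem_range]
    omega
  · intro i hi
    rw [Finset.mem_range] at hi
    rw [Finset.mem_Icc]
    omega
  · intro k hk
    rw [Finset.mem_Icc] at hk
    omega
  · intro i hi
    omega
  · intro k hk
    rw [Finset.mem_Icc] at hk
    congr 1
    omega

section Circle

variable {Y Z : Type*} [AddCommGroup Y] [Module ℂ Y] [TopologicalSpace Y]
  [AddCommGroup Z] [Module ℂ Z] [TopologicalSpace Z]

theorem HasCircleIntegral.congr {f g : ℂ → Y} {c : ℂ} {r : ℝ} (hr : 0 ≤ r) {y : Y}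
    (h : HasCircleIntegral f c r y) (hfg : ∀ z ∈ Metric.sphere c r, f z = g z) :
    HasCircleIntegral g c r y := by
  have : (fun θ : ℝ => deriv (circleMap c r) θ • f (circleMap c r θ)) =
      fun θ : ℝ => deriv (circleMap c r) θ • g (circleMap c r θ) :=
    funext fun θ => by rw [hfg _ (circleMap_mem_sphere c hr θ)]
  rwa [HasCircleIntegral, this] at h

theorem HasCircleIntegral.map (L : Y →L[ℂ] Z) {f : ℂ → Y} {c : ℂ} {r : ℝ} {y : Y}
    (h : HasCircleIntegral f c r y) : HasCircleIntegral (fun z => L (f z)) c r (L y) := by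
  simpa only [HasCircleIntegral, map_smul] using HasRiemannIntegral.map L h

end Circle

/-! ### Taylor and Laurent expansions in Banach spaces. -/

section Laurent

variable {E : Type*} [NormedAddCommGroup E] [NormedSpace ℂ E] [CompleteSpace E]

theorem exists_taylor_expansion {H : ℂ → E} {c : ℂ} {R : ℝ} (hR : 0 < R)
    (hH : DifferentiableOn ℂ H (Metric.ball c R)) :
    ∃ α : ℕ → E, α 0 = H c ∧
      TendstoLocallyUniformlyOn (fun (N : ℕ) z => ∑ i ∈ Finset.range N, (z - c) ^ i • α i) H atTop
        (Metric.ball c R) ∧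
      ∀ (m : ℕ) (r : ℝ), 0 < r → r < R →
        HasCircleIntegral (fun z => ((z - c) ^ (m + 1))⁻¹ • H z) c r
          ((2 * (Real.pi : ℂ) * Complex.I) • α m) := by
  have hser : ∀ r : ℝ≥0, 0 < r → (r : ℝ) < R →
      HasFPowerSeriesOnBall H (cauchyPowerSeries H c r) c r := fun r h0 hr =>
    (hH.mono (Metric.closedBall_subset_ball hr)).hasFPowerSeriesOnBall h0
  obtain ⟨r₀, hr₀, hr₀R⟩ : ∃ r₀ : ℝ≥0, 0 < r₀ ∧ (r₀ : ℝ) < R := by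
    refine ⟨(R / 2).toNNReal, Real.toNNReal_pos.2 (by positivity), ?_⟩
    rw [Real.coe_toNNReal _ (by positivity)]
    linarith
  have h0 := hser r₀ hr₀ hr₀R
  set p := cauchyPowerSeries H c r₀
  -- Uniqueness of power series makes the coefficients independent of the circle, so one series
  -- serves every radius below `R`.
  have hp : ∀ r : ℝ≥0, 0 < r → (r : ℝ) < R → cauchyPowerSeries H c r = p := fun r hr hrR =>
    (hser r hr hrR).hasFPowerSeriesAt.eq_formalMultilinearSeries h0.hasFPowerSeriesAt
  refine ⟨p.coeff, h0.coeff_zero _, ?_, ?_⟩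
  · intro U hU z hz
    obtain ⟨r, hzr, hrR⟩ := exists_between (Metric.mem_ball.1 hz)
    have hr0 : 0 < r := dist_nonneg.trans_lt hzr
    lift r to ℝ≥0 using hr0.le
    have h := (hser r (by exact_mod_cast hr0) hrR).tendstoLocallyUniformlyOn'
    rw [hp r (by exact_mod_cast hr0) hrR, Metric.eball_coe] at h
    obtain ⟨t, ht, hev⟩ := h U hU z hzr
    rw [Metric.isOpen_ball.nhdsWithin_eq hzr] at ht
    refine ⟨t, mem_nhdsWithin_of_mem_nhds ht, hev.mono fun N hN y hy => ?_⟩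
    have := hN y hy
    simpa only [FormalMultilinearSeries.partialSum, FormalMultilinearSeries.apply_eq_pow_smul_coeff]
      using this
  · intro m r hr hrR
    have hcont : ContinuousOn H (Metric.sphere c r) :=
      hH.continuousOn.mono (Metric.sphere_subset_closedBall.trans
        (Metric.closedBall_subset_ball hrR))
    have hne : ∀ θ : ℝ, circleMap c r θ - c ≠ 0 := fun θ =>
      sub_ne_zero.2 (circleMap_ne_center hr.ne')
    have hHc : Continuous fun θ : ℝ => H (circleMap c r θ) :=
      hcont.comp_continuous (continuous_circleMap c r) (circleMap_mem_sphere c hr.le)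
    have hcf : Continuous fun θ : ℝ => deriv (circleMap c r) θ •
        ((circleMap c r θ - c) ^ (m + 1))⁻¹ • H (circleMap c r θ) := by
      refine Continuous.smul ?_ (Continuous.smul ?_ hHc)
      · rw [funext (deriv_circleMap c r)]
        fun_prop
      · exact (((continuous_circleMap c r).sub continuous_const).pow _).inv₀
          fun θ => pow_ne_zero _ (hne θ)
    have hint := hasRiemannIntegral_of_continuous hcf Real.two_pi_pos.le
    have hval : (2 * (Real.pi : ℂ) * Complex.I) • p.coeff m =
        ∮ z in C(c, r), ((z - c) ^ (m + 1))⁻¹ • H z := by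
      lift r to ℝ≥0 using hr.le
      rw [← hp r (by exact_mod_cast hr) hrR, FormalMultilinearSeries.coeff]
      have := cauchyPowerSeries_apply H c r m 1
      rw [show (1 : Fin m → ℂ) = fun _ => 1 from rfl, this, smul_inv_smul₀ Complex.two_pi_I_ne_zero]
      refine circleIntegral.integral_congr r.coe_nonneg fun z _ => ?_
      simp only [smul_smul, one_div, pow_succ, mul_inv, inv_pow]
    rw [hval]
    exact hint

theorem exists_laurent_expansion {H Φ : ℂ → E} {c : ℂ} {R : ℝ} (hR : 0 < R)
    (hH : DifferentiableOn ℂ H (Metric.ball c R))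
    (hΦ : ∀ z ∈ puncturedDisc c R, Φ z = (z - c)⁻¹ • H z) :
    ∃ a : ℤ → E, a (-1) = H c ∧
      TendstoLocallyUniformlyOn
        (fun (N : ℕ) z => ∑ k ∈ Finset.Icc (-1 : ℤ) N, (z - c) ^ k • a k) Φ atTop
        (puncturedDisc c R) ∧
      ∀ k : ℤ, -1 ≤ k → ∀ r : ℝ, 0 < r → r < R →
        HasCircleIntegral (fun z => ((z - c) ^ (k + 1))⁻¹ • Φ z) c r
          ((2 * (Real.pi : ℂ) * Complex.I) • a k) := by
  obtain ⟨α, h0, hunif, hcirc⟩ := exists_taylor_expansion hR hH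
  have hne : ∀ z ∈ puncturedDisc c R, z - c ≠ 0 := fun z hz => norm_pos_iff.1 hz.1
  refine ⟨fun k => α (k + 1).toNat, by simpa using h0, ?_, fun k hk r hr hrR => ?_⟩
  · rw [tendstoLocallyUniformlyOn_iff_tendsto_sub] at hunif ⊢
    intro x hx
    have hsub : puncturedDisc c R ⊆ Metric.ball c R := fun z hz => by
      rw [mem_ball_iff_norm]; exact hz.2
    -- The Laurent sum over `-1 ≤ k ≤ N` has `N + 2` terms: it is `(z - c)⁻¹` times the Taylor sum
    -- over `range (N + 2)`.
    have hshift : Tendsto (fun y : ℕ × ℂ => (y.1 + 2, y.2)) (atTop ×ˢ 𝓝[puncturedDisc c R] x)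
        (atTop ×ˢ 𝓝[Metric.ball c R] x) :=
      ((tendsto_add_atTop_nat 2).comp tendsto_fst).prodMk
        ((tendsto_id.mono_left (nhdsWithin_mono x hsub)).comp tendsto_snd)
    have hinv : Tendsto (fun y : ℕ × ℂ => (y.2 - c)⁻¹) (atTop ×ˢ 𝓝[puncturedDisc c R] x)
        (𝓝 (x - c)⁻¹) := by
      have : Tendsto (fun z : ℂ => (z - c)⁻¹) (𝓝[puncturedDisc c R] x) (𝓝 (x - c)⁻¹) :=
        (((continuous_id.sub continuous_const).tendsto x).inv₀ (hne x hx)).mono_left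
          nhdsWithin_le_nhds
      exact this.comp tendsto_snd
    have hmul := hinv.smul ((hunif x (hsub hx)).comp hshift)
    rw [smul_zero] at hmul
    refine hmul.congr' ?_
    have hev : ∀ᶠ y : ℕ × ℂ in atTop ×ˢ 𝓝[puncturedDisc c R] x, y.2 ∈ puncturedDisc c R :=
      tendsto_snd.eventually self_mem_nhdsWithin
    filter_upwards [hev] with y hy
    rw [Function.comp_apply, smul_sub, hΦ y.2 hy, sum_Icc_neg_one, Finset.smul_sum]
    congr 1
    refine Finset.sum_congr rfl fun i _ => ?_
    rw [smul_smul, sub_add_cancel, Int.toNat_natCast, zpow_sub₀ (hne y.2 hy), zpow_natCast,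
      zpow_one, div_eq_inv_mul]
  · obtain ⟨m, hm⟩ := Int.eq_ofNat_of_zero_le (show 0 ≤ k + 1 by omega)
    simp only [hm, Int.toNat_natCast, zpow_natCast]
    refine (hcirc m r hr hrR).congr hr.le fun z hz => ?_
    rw [mem_sphere_iff_norm] at hz
    rw [hΦ z ⟨by rwa [hz], by rwa [hz]⟩, smul_smul, pow_succ, mul_inv]

end Laurent

/-! ### Laurent expansion of `ω(μ)⁻¹ e_μ` in `C([0,ρ], ℂ)`. -/

theorem norm_latticePoint_sub {ρ : ℝ≥0} (m n : ℤ) :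
    ‖latticePoint ρ m - latticePoint ρ n‖ = 2 * Real.pi / ρ * |(m : ℝ) - n| := by
  have : latticePoint ρ m - latticePoint ρ n =
      ((2 * Real.pi / ρ * ((m : ℝ) - n) : ℝ) : ℂ) * Complex.I := by
    simp only [latticePoint]
    push_cast
    ring
  rw [this, norm_mul, Complex.norm_I, mul_one, Complex.norm_real, norm_mul, Real.norm_eq_abs,
    abs_of_nonneg (by positivity), Real.norm_eq_abs]

theorem notMem_lattice_of_mem_puncturedDisc {ρ : ℝ≥0} {n : ℤ} {μ : ℂ}
    (hμ : μ ∈ puncturedDisc (latticePoint ρ n) (2 * Real.pi / ρ)) : μ ∉ lattice ρ := by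
  rintro ⟨m, rfl⟩
  obtain ⟨h0, h1⟩ := hμ
  rw [norm_latticePoint_sub] at h0 h1
  have hmn : m ≠ n := by
    rintro rfl
    simp at h0
  have hR : (0 : ℝ) ≤ 2 * Real.pi / ρ := by positivity
  have : (1 : ℝ) ≤ |(m : ℝ) - n| := by
    exact_mod_cast Int.one_le_abs (sub_ne_zero.2 hmn)
  nlinarith

/-- The function `(μ - c) / (1 - exp (-μ ρ))`, extended to `c`, for a lattice point `c`. -/
def regularFactor (ρ : ℝ≥0) (c μ : ℂ) : ℂ := (dslope (expDefect ρ) c μ)⁻¹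

/-- The zero at the centre is simple, and the disc meets no other lattice point. -/
theorem dslope_expDefect_latticePoint_ne_zero {ρ : ℝ≥0} (hρ : 0 < ρ) {n : ℤ} {μ : ℂ}
    (hμ : μ ∈ Metric.ball (latticePoint ρ n) (2 * Real.pi / ρ)) :
    dslope (expDefect ρ) (latticePoint ρ n) μ ≠ 0 := by
  rcases eq_or_ne μ (latticePoint ρ n) with rfl | hne
  · rw [dslope_same, (hasDerivAt_expDefect_latticePoint hρ n).deriv]
    exact_mod_cast hρ.ne'
  · rw [dslope_of_ne _ hne, slope_def_module, expDefect_latticePoint hρ, sub_zero]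
    refine smul_ne_zero (inv_ne_zero (sub_ne_zero.2 hne)) ?_
    rw [Ne, expDefect_eq_zero_iff hρ]
    rw [mem_ball_iff_norm] at hμ
    exact notMem_lattice_of_mem_puncturedDisc ⟨norm_pos_iff.2 (sub_ne_zero.2 hne), hμ⟩

theorem differentiableOn_regularFactor {ρ : ℝ≥0} (hρ : 0 < ρ) (n : ℤ) :
    DifferentiableOn ℂ (regularFactor ρ (latticePoint ρ n))
      (Metric.ball (latticePoint ρ n) (2 * Real.pi / ρ)) := by
  have hpos : (0 : ℝ) < 2 * Real.pi / ρ := by positivity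
  refine DifferentiableOn.inv ?_ fun μ hμ => dslope_expDefect_latticePoint_ne_zero hρ hμ
  exact (Complex.differentiableOn_dslope (Metric.ball_mem_nhds _ hpos)).2
    (differentiable_expDefect ρ).differentiableOn

theorem regularFactor_same {ρ : ℝ≥0} (hρ : 0 < ρ) (n : ℤ) :
    regularFactor ρ (latticePoint ρ n) (latticePoint ρ n) = ((ρ : ℝ) : ℂ)⁻¹ := by
  rw [regularFactor, dslope_same, (hasDerivAt_expDefect_latticePoint hρ n).deriv]

theorem regularFactor_of_ne {ρ : ℝ≥0} (hρ : 0 < ρ) {n : ℤ} {μ : ℂ} (hμ : μ ≠ latticePoint ρ n) :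
    regularFactor ρ (latticePoint ρ n) μ = (μ - latticePoint ρ n) * (expDefect ρ μ)⁻¹ := by
  rw [regularFactor, dslope_of_ne _ hμ, slope_def_module, expDefect_latticePoint hρ, sub_zero,
    smul_eq_mul, mul_inv, inv_inv]

/-- The target need not be normed, so the chain rule is argued with the asymptotic relations of
topological vector spaces. -/
theorem differentiableOn_clm_comp {E Y : Type*} [NormedAddCommGroup E] [NormedSpace ℂ E]
    [AddCommGroup Y] [Module ℂ Y] [TopologicalSpace Y] (L : E →L[ℂ] Y) {f : ℂ → E} {s : Set ℂ}
    (hf : DifferentiableOn ℂ f s) : DifferentiableOn ℂ (fun z => L (f z)) s := by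
  intro z hz
  obtain ⟨f', hf'⟩ := hf z hz
  refine ⟨L.comp f', .of_isLittleOTVS ?_⟩
  have := (L.isBigOTVS_fun_comp).trans_isLittleOTVS hf'.isLittleOTVS
  simpa using this

theorem exists_laurent_coefficients {ρ : ℝ≥0} (hρ : 0 < ρ) (n : ℤ) :
    ∃ α : ℤ → C(Icc (0 : ℝ) ρ, ℂ),
      α (-1) = ((ρ : ℝ) : ℂ)⁻¹ • expFun ρ (latticePoint ρ n) ∧
      TendstoLocallyUniformlyOn
        (fun (N : ℕ) μ => ∑ k ∈ Finset.Icc (-1 : ℤ) N, (μ - latticePoint ρ n) ^ k • α k)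
        (fun μ => (expDefect ρ μ)⁻¹ • expFun ρ μ) atTop
        (puncturedDisc (latticePoint ρ n) (2 * Real.pi / ρ)) ∧
      ∀ k : ℤ, -1 ≤ k → ∀ r : ℝ, 0 < r → r < 2 * Real.pi / ρ →
        HasCircleIntegral
          (fun z => ((z - latticePoint ρ n) ^ (k + 1))⁻¹ • (expDefect ρ z)⁻¹ • expFun ρ z)
          (latticePoint ρ n) r ((2 * (Real.pi : ℂ) * Complex.I) • α k) := by
  have := exists_laurent_expansion
    (H := fun μ => regularFactor ρ (latticePoint ρ n) μ • expFun ρ μ)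
    (Φ := fun μ => (expDefect ρ μ)⁻¹ • expFun ρ μ) (by positivity)
    ((differentiableOn_regularFactor hρ n).smul (differentiable_expFun ρ).differentiableOn)
    fun z hz => ?_
  · simpa only [regularFactor_same hρ] using this
  · have hz0 : z - latticePoint ρ n ≠ 0 := norm_pos_iff.1 hz.1
    rw [regularFactor_of_ne hρ (sub_ne_zero.1 hz0), smul_smul, inv_mul_cancel_left₀ hz0]

/-! ### Transport of the expansions along a continuous linear map. -/

section Push

variable {Z : Type*} [AddCommGroup Z] [Module ℂ Z] {ρ : ℝ≥0} {n : ℤ}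
  {Φ : ℂ → C(Icc (0 : ℝ) ρ, ℂ)} {α : ℤ → C(Icc (0 : ℝ) ρ, ℂ)} {g : ℂ → Z}

theorem tendsto_laurent_map [UniformSpace Z] [IsUniformAddGroup Z]
    (L : C(Icc (0 : ℝ) ρ, ℂ) →L[ℂ] Z) (hg : ∀ μ ∉ lattice ρ, g μ = L (Φ μ))
    (h : TendstoLocallyUniformlyOn
      (fun (N : ℕ) μ => ∑ k ∈ Finset.Icc (-1 : ℤ) N, (μ - latticePoint ρ n) ^ k • α k) Φ atTop
      (puncturedDisc (latticePoint ρ n) (2 * Real.pi / ρ))) :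
    TendstoLocallyUniformlyOn
      (fun (N : ℕ) μ => ∑ k ∈ Finset.Icc (-1 : ℤ) N, (μ - latticePoint ρ n) ^ k • L (α k)) g atTop
      (puncturedDisc (latticePoint ρ n) (2 * Real.pi / ρ)) := by
  have := (TendstoLocallyUniformlyOn.map_clm L h).congr_right
    fun μ hμ => (hg μ (notMem_lattice_of_mem_puncturedDisc hμ)).symm
  simpa only [map_sum, map_smul] using this

theorem hasCircleIntegral_laurent_map [TopologicalSpace Z] (L : C(Icc (0 : ℝ) ρ, ℂ) →L[ℂ] Z)
    (hg : ∀ μ ∉ lattice ρ, g μ = L (Φ μ)) {k : ℤ} {r : ℝ} (hr : 0 < r)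
    (hrR : r < 2 * Real.pi / ρ) {y : C(Icc (0 : ℝ) ρ, ℂ)}
    (h : HasCircleIntegral (fun z => ((z - latticePoint ρ n) ^ (k + 1))⁻¹ • Φ z)
      (latticePoint ρ n) r y) :
    HasCircleIntegral (fun z => ((z - latticePoint ρ n) ^ (k + 1))⁻¹ • g z)
      (latticePoint ρ n) r (L y) := by
  refine (h.map L).congr hr.le fun z hz => ?_
  rw [mem_sphere_iff_norm] at hz
  rw [map_smul, hg z (notMem_lattice_of_mem_puncturedDisc (n := n) ⟨by rwa [hz], by rwa [hz]⟩)]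

end Push

theorem res_eq_of_inverse {X : Type*} [AddCommGroup X] [Module ℂ X] [TopologicalSpace X]
    {A : X →ₗ.[ℂ] X} {μ : ℂ} (R : X →L[ℂ] X) (hl : ∀ x : A.domain, R (scalarSub A μ x) = x)
    (hr : ∀ x, ∃ h : R x ∈ A.domain, scalarSub A μ ⟨R x, h⟩ = x) :
    μ ∈ resolventDomain A ∧ res A μ = R := by
  have hmem : μ ∈ resolventDomain A := by
    refine ⟨⟨fun x y hxy => Subtype.ext ?_, fun x => ?_⟩, R, hl⟩
    · rw [← hl x, ← hl y, hxy]
    · obtain ⟨h, hx⟩ := hr x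
      exact ⟨_, hx⟩
  refine ⟨hmem, ContinuousLinearMap.ext fun x => ?_⟩
  obtain ⟨h, hx⟩ := hr x
  have := res_scalarSub hmem ⟨R x, h⟩
  rwa [hx] at this

theorem scalarSub_add_smul {X : Type*} [AddCommGroup X] [Module ℂ X] (A : X →ₗ.[ℂ] X) (μ ν : ℂ)
    (x : A.domain) : scalarSub A μ x = scalarSub A ν x + (μ - ν) • (x : X) := by
  simp only [scalarSub, LinearMap.sub_apply, LinearMap.smul_apply, Submodule.subtype_apply]
  module

/-! ### Resolvent, residues and spectrum of the generator. -/

section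

variable {X : Type*} [AddCommGroup X] [Module ℂ X] [UniformSpace X] [IsUniformAddGroup X]
  [ContinuousSMul ℂ X] {T : ℝ≥0 → X →L[ℂ] X} {ρ : ℝ≥0}
  {I : C(Icc (0 : ℝ) ρ, ℂ) →L[ℂ] X →L[ℂ] X}

/-- The continuous linear map `φ ↦ I φ x`. -/
def evalIntegral (I : C(Icc (0 : ℝ) ρ, ℂ) →L[ℂ] X →L[ℂ] X) (x : X) : C(Icc (0 : ℝ) ρ, ℂ) →L[ℂ] X :=
  ⟨{ toFun := fun φ => I φ x
     map_add' := by simp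
     map_smul' := by simp }, (continuous_eval_const x).comp I.continuous⟩

variable [LocallyConvexSpace ℝ X]

/-- Near `μ` the norms `‖Φ η‖` are bounded, and `q(I φ x) ≤ C ‖φ‖ p(x)` turns this into
equicontinuity. -/
theorem mem_resolventDomainStar_of_continuousAt (hequi : IsLocallyEquicontinuous T)
    (hI : IsOrbitIntegral T ρ I) {A : X →ₗ.[ℂ] X} {Φ : ℂ → C(Icc (0 : ℝ) ρ, ℂ)} {μ : ℂ}
    (hΦ : ContinuousAt Φ μ)
    (hres : ∀ᶠ η in 𝓝 μ, η ∈ resolventDomain A ∧ res A η = I (Φ η)) :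
    μ ∈ resolventDomainStar A := by
  have hbd : ∀ᶠ η in 𝓝 μ, ‖Φ η‖ < ‖Φ μ‖ + 1 :=
    hΦ.norm.eventually (gt_mem_nhds (lt_add_one _))
  obtain ⟨δ, hδ, H⟩ := Metric.eventually_nhds_iff_ball.1 (hres.and hbd)
  refine ⟨hres.self_of_nhds.1, δ, hδ, fun η hη => (H η hη).1.1, ?_⟩
  refine equicontinuous_of_equicontinuousAt_zero (fun η : Metric.ball μ δ => res A η) ?_
  intro U hU
  rw [uniformity_eq_comap_nhds_zero] at hU
  obtain ⟨V, hV, hVU⟩ := hU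
  obtain ⟨q, hq, hqV⟩ := exists_seminorm_ball_subset hV
  obtain ⟨p, hp, C, hC0, hC⟩ := exists_seminorm_bound_of_hasBanachIntegral hequi hI q hq
  have h0 : Tendsto (fun x => C * (‖Φ μ‖ + 1) * p x) (𝓝 0) (𝓝 0) := by
    simpa using (hp.tendsto 0).const_mul (C * (‖Φ μ‖ + 1))
  filter_upwards [h0.eventually (gt_mem_nhds one_pos)] with x hx η
  refine hVU (hqV _ ?_)
  simp only [Function.comp_apply, map_zero, sub_zero]
  rw [(H η η.2).1.2]
  refine (hC _ x).trans_lt (lt_of_le_of_lt ?_ hx)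
  have := (H η η.2).2.le
  gcongr

variable [T2Space X]

section Resolvent

variable (hI : IsOrbitIntegral T ρ I) (hT : IsSemigroup T) (hcont : IsStronglyContinuous T)
  (hTρ : T ρ = ContinuousLinearMap.id ℂ X)

include hI hT hcont hTρ

theorem integral_scalarSub (μ : ℂ) (x : (generator T).domain) :
    I (expFun ρ μ) (scalarSub (generator T) μ x) = expDefect ρ μ • (x : X) := by
  have := hI.map_generatorValue hT hcont hTρ μ (generator_spec T x)
  change I (expFun ρ μ) (μ • (x : X) - generator T x) = _
  rw [map_sub, map_smul, this, sub_sub_cancel]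

theorem scalarSub_integral (μ : ℂ) (x : X) :
    ∃ h : I (expFun ρ μ) x ∈ (generator T).domain,
      scalarSub (generator T) μ ⟨I (expFun ρ μ) x, h⟩ = expDefect ρ μ • x := by
  have hv := hI.hasGeneratorValue hT hcont hTρ μ x
  refine ⟨⟨_, hv⟩, ?_⟩
  have := (generator_spec T ⟨_, ⟨_, hv⟩⟩).unique hv
  change μ • I (expFun ρ μ) x - generator T _ = _
  rw [this, sub_sub_cancel]

theorem res_generator (hρ : 0 < ρ) {μ : ℂ} (hμ : μ ∉ lattice ρ) :
    μ ∈ resolventDomain (generator T) ∧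
      res (generator T) μ = I ((expDefect ρ μ)⁻¹ • expFun ρ μ) := by
  have hω : expDefect ρ μ ≠ 0 := fun h => hμ ((expDefect_eq_zero_iff hρ).1 h)
  refine res_eq_of_inverse _ (fun x => ?_) fun x => ?_
  · rw [map_smul, smul_apply, integral_scalarSub hI hT hcont hTρ, inv_smul_smul₀ hω]
  · obtain ⟨h, hx⟩ := scalarSub_integral hI hT hcont hTρ μ x
    have hmem := (generator T).domain.smul_mem (expDefect ρ μ)⁻¹ h
    refine ⟨by simpa using hmem, ?_⟩
    have e : scalarSub (generator T) μ ((expDefect ρ μ)⁻¹ • ⟨I (expFun ρ μ) x, h⟩) = x := by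
      rw [map_smul, hx, inv_smul_smul₀ hω]
    convert! e using 2
    ext
    simp

/-- For `x` in `ker(c - A)` one has `(η - c) I(e_η)x = ω(η)x`; divide by `η - c` and let `η → c`,
using `ω'(c) = ρ`. -/
theorem integral_of_scalarSub_eq_zero (hρ : 0 < ρ) (n : ℤ) {x : (generator T).domain}
    (hx : scalarSub (generator T) (latticePoint ρ n) x = 0) :
    I (expFun ρ (latticePoint ρ n)) x = ((ρ : ℝ) : ℂ) • (x : X) := by
  set c := latticePoint ρ n
  have h1 : Tendsto (fun η => I (expFun ρ η) x) (𝓝[≠] c) (𝓝 (I (expFun ρ c) x)) :=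
    (((evalIntegral I x).continuous.comp (differentiable_expFun ρ).continuous).tendsto c).mono_left
      nhdsWithin_le_nhds
  have h2 : Tendsto (fun η => slope (expDefect ρ) c η • (x : X)) (𝓝[≠] c)
      (𝓝 (((ρ : ℝ) : ℂ) • (x : X))) :=
    (hasDerivAt_iff_tendsto_slope.1 (hasDerivAt_expDefect_latticePoint hρ n)).smul_const _
  refine tendsto_nhds_unique (h1.congr' ?_) h2
  filter_upwards [self_mem_nhdsWithin] with η hη
  have := integral_scalarSub hI hT hcont hTρ η x
  rw [scalarSub_add_smul _ η c, hx, zero_add, map_smul] at this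
  rw [slope_def_module, expDefect_latticePoint hρ, sub_zero, smul_assoc, ← this,
    inv_smul_smul₀ (sub_ne_zero.2 hη)]

theorem mem_resolventDomainStar_of_notMem_lattice (hequi : IsLocallyEquicontinuous T) (hρ : 0 < ρ)
    {μ : ℂ} (hμ : μ ∉ lattice ρ) : μ ∈ resolventDomainStar (generator T) := by
  have hω : expDefect ρ μ ≠ 0 := fun h => hμ ((expDefect_eq_zero_iff hρ).1 h)
  have hc := (differentiable_expDefect ρ).continuous.continuousAt (x := μ)
  refine mem_resolventDomainStar_of_continuousAt hequi hI
    (Φ := fun η => (expDefect ρ η)⁻¹ • expFun ρ η)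
    ((hc.inv₀ hω).smul (differentiable_expFun ρ).continuous.continuousAt) ?_
  filter_upwards [hc.eventually_ne hω] with η hη
  exact res_generator hI hT hcont hTρ hρ fun h => hη ((expDefect_eq_zero_iff hρ).2 h)

/-- The residue vanishes, so the resolvent extends continuously to `c`, and the extension is shown
to invert `c - A`. -/
theorem mem_resolventDomainStar_of_injective (hequi : IsLocallyEquicontinuous T) (hρ : 0 < ρ)
    (n : ℤ) (hinj : Function.Injective (scalarSub (generator T) (latticePoint ρ n))) :
    latticePoint ρ n ∈ resolventDomainStar (generator T) := by
  set c := latticePoint ρ n with hcdef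
  set A := generator T
  have hpos : (0 : ℝ) < 2 * Real.pi / ρ := by positivity
  have hzero : I (expFun ρ c) = 0 := by
    ext x
    obtain ⟨h, hx⟩ := scalarSub_integral hI hT hcont hTρ c x
    rw [expDefect_latticePoint hρ, zero_smul, ← map_zero (scalarSub A c)] at hx
    exact congrArg Subtype.val (hinj hx)
  -- As `I(e_c) = 0`, replacing `e_η` by `e_η - e_c` leaves `I` unchanged, and the factor `η - c`
  -- cancels the pole. The function `Φ` itself is continuous at `c`.
  obtain ⟨Φ, hΦdef⟩ : ∃ Φ : ℂ → C(Icc (0 : ℝ) ρ, ℂ),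
      Φ = fun η => regularFactor ρ c η • dslope (expFun ρ) c η := ⟨_, rfl⟩
  have hΦ : ContinuousAt Φ c := hΦdef ▸
    ((differentiableOn_regularFactor hρ n).continuousOn.continuousAt
      (Metric.ball_mem_nhds _ hpos)).smul
      (continuousAt_dslope_same.2 (differentiable_expFun ρ c))
  have hne : ∀ η ∈ Metric.ball c (2 * Real.pi / ρ), η ≠ c →
      η ∈ resolventDomain A ∧ res A η = I (Φ η) := by
    intro η hη hηc
    rw [mem_ball_iff_norm] at hη
    have := res_generator hI hT hcont hTρ hρ
      (notMem_lattice_of_mem_puncturedDisc ⟨norm_pos_iff.2 (sub_ne_zero.2 hηc), hη⟩)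
    refine ⟨this.1, this.2.trans ?_⟩
    simp only [hΦdef]
    rw [regularFactor_of_ne hρ hηc, dslope_of_ne _ hηc, slope_def_module, smul_smul, map_smul,
      map_smul, map_sub, hzero, sub_zero]
    congr 1
    rw [mul_right_comm, mul_inv_cancel₀ (sub_ne_zero.2 hηc), one_mul]
  have hev : ∀ᶠ η in 𝓝[≠] c, η ∈ resolventDomain A ∧ res A η = I (Φ η) := by
    filter_upwards [self_mem_nhdsWithin, mem_nhdsWithin_of_mem_nhds (Metric.ball_mem_nhds c hpos)]
      with η h1 h2 using hne η h2 h1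
  have hlim : ∀ z, Tendsto (fun η => I (Φ η) z) (𝓝[≠] c) (𝓝 (I (Φ c) z)) := fun z =>
    ((evalIntegral I z).continuous.continuousAt.comp hΦ).tendsto.mono_left nhdsWithin_le_nhds
  have hleft : ∀ x : A.domain, I (Φ c) (scalarSub A c x) = x := by
    intro x
    have hsub : Tendsto (fun η => (η - c) • I (Φ η) x) (𝓝[≠] c) (𝓝 0) := by
      have h0 : Tendsto (fun η : ℂ => η - c) (𝓝[≠] c) (𝓝 0) := by
        simpa using ((continuous_sub_right c).tendsto c).mono_left nhdsWithin_le_nhds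
      simpa using h0.smul (hlim x)
    have h2 : Tendsto (fun η => (x : X) - (η - c) • I (Φ η) x) (𝓝[≠] c) (𝓝 (x : X)) := by
      simpa using tendsto_const_nhds.sub hsub
    refine tendsto_nhds_unique ((hlim _).congr' ?_) h2
    filter_upwards [hev] with η hη
    have h3 := res_scalarSub hη.1 x
    rw [hη.2, scalarSub_add_smul _ η c, map_add, map_smul] at h3
    exact eq_sub_of_add_eq h3
  obtain ⟨l, hl⟩ := hev.exists
  -- A resolvent identity with a nearby regular point `l`, together with commutation, writes `I (Φ
  -- c) x` as a value of `res A l`. This places it in the domain.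
  have hright : ∀ x, ∃ h : I (Φ c) x ∈ A.domain, scalarSub A c ⟨I (Φ c) x, h⟩ = x := by
    intro x
    obtain ⟨hd, hx⟩ := scalarSub_res hl.1 x
    have h1 := hleft ⟨res A l x, hd⟩
    rw [scalarSub_add_smul _ c l, hx, map_add, map_smul] at h1
    have hcomm : I (Φ c) (res A l x) = res A l (I (Φ c) x) := by
      rw [hl.2, hI.integral_comm hT]
    have h2 : I (Φ c) x = res A l (x - (c - l) • I (Φ c) x) := by
      rw [map_sub, map_smul, ← hcomm]
      exact eq_sub_of_add_eq h1
    obtain ⟨hd', hx'⟩ := scalarSub_res hl.1 (x - (c - l) • I (Φ c) x)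
    rw [← h2] at hd'
    refine ⟨hd', ?_⟩
    have h3 : scalarSub A l ⟨I (Φ c) x, hd'⟩ = x - (c - l) • I (Φ c) x := by
      convert! hx' using 2
      exact Subtype.ext h2
    rw [scalarSub_add_smul _ c l, h3, sub_add_cancel]
  refine mem_resolventDomainStar_of_continuousAt hequi hI hΦ ?_
  filter_upwards [Metric.ball_mem_nhds c hpos] with η hη
  rcases eq_or_ne η c with rfl | hηc
  · exact res_eq_of_inverse _ hleft hright
  · exact hne η hη hηc

theorem specStar_generator_subset (hequi : IsLocallyEquicontinuous T) (hρ : 0 < ρ) :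
    specStar (generator T) ⊆ lattice ρ := fun _ hμ => by_contra fun h =>
  hμ (mem_resolventDomainStar_of_notMem_lattice hI hT hcont hTρ hequi hρ h)

theorem specStar_generator_eq (hequi : IsLocallyEquicontinuous T) (hρ : 0 < ρ) :
    specStar (generator T) = pointSpec (generator T) := by
  refine Subset.antisymm (fun μ hμ hinj => ?_) fun μ hμ hstar => hμ hstar.1.1.1
  obtain ⟨n, rfl⟩ := specStar_generator_subset hI hT hcont hTρ hequi hρ hμ
  exact hμ (mem_resolventDomainStar_of_injective hI hT hcont hTρ hequi hρ n hinj)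

theorem differentiableOn_res_generator (hρ : 0 < ρ) :
    DifferentiableOn ℂ (fun μ => res (generator T) μ) (lattice ρ)ᶜ := by
  have : DifferentiableOn ℂ (fun μ => (expDefect ρ μ)⁻¹ • expFun ρ μ) (lattice ρ)ᶜ :=
    ((differentiable_expDefect ρ).differentiableOn.inv fun μ (hμ : μ ∉ lattice ρ) h =>
      hμ ((expDefect_eq_zero_iff hρ).1 h)).smul (differentiable_expFun ρ).differentiableOn
  exact (differentiableOn_clm_comp I this).congr fun μ hμ =>
    (res_generator hI hT hcont hTρ hρ hμ).2

/-- At a lattice point `(c - A) I(e_c) = ω(c) = 0`, so the range lies in the kernel; conversely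
`I(e_c)/ρ` is the identity on the kernel. -/
theorem range_residue (hρ : 0 < ρ) (n : ℤ) :
    LinearMap.range (I (((ρ : ℝ) : ℂ)⁻¹ • expFun ρ (latticePoint ρ n)) : X →ₗ[ℂ] X) =
      kerScalarSub (generator T) (latticePoint ρ n) := by
  have hρ' : ((ρ : ℝ) : ℂ) ≠ 0 := by exact_mod_cast hρ.ne'
  refine le_antisymm ?_ ?_
  · rintro _ ⟨x, rfl⟩
    obtain ⟨h, hx⟩ := scalarSub_integral hI hT hcont hTρ (latticePoint ρ n) x
    rw [expDefect_latticePoint hρ, zero_smul] at hx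
    rw [ContinuousLinearMap.coe_coe, map_smul, smul_apply]
    exact Submodule.smul_mem _ _ ⟨⟨_, h⟩, hx, rfl⟩
  · rintro _ ⟨x, hx, rfl⟩
    refine ⟨x, ?_⟩
    rw [ContinuousLinearMap.coe_coe, map_smul, smul_apply,
      integral_of_scalarSub_eq_zero hI hT hcont hTρ hρ n hx, inv_smul_smul₀ hρ']
    rfl

theorem residue_comp_self (hρ : 0 < ρ) (n : ℤ) :
    (I (((ρ : ℝ) : ℂ)⁻¹ • expFun ρ (latticePoint ρ n))).comp
      (I (((ρ : ℝ) : ℂ)⁻¹ • expFun ρ (latticePoint ρ n))) =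
      I (((ρ : ℝ) : ℂ)⁻¹ • expFun ρ (latticePoint ρ n)) := by
  have hρ' : ((ρ : ℝ) : ℂ) ≠ 0 := by exact_mod_cast hρ.ne'
  ext x
  set P := I (((ρ : ℝ) : ℂ)⁻¹ • expFun ρ (latticePoint ρ n)) with hP
  have hmem : P x ∈ kerScalarSub (generator T) (latticePoint ρ n) := by
    rw [← range_residue hI hT hcont hTρ hρ n]
    exact ⟨x, rfl⟩
  obtain ⟨y, hy, hyx⟩ := hmem
  rw [ContinuousLinearMap.comp_apply, ← hyx, Submodule.subtype_apply, hP, map_smul, smul_apply,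
    integral_of_scalarSub_eq_zero hI hT hcont hTρ hρ n hy, inv_smul_smul₀ hρ']

/-- Near `c`, `(μ - c) R(μ,A)` is `I` applied to `regularFactor` times `e_μ`, a function continuous
at `c`, where the factor equals `1/ρ`. -/
theorem tendsto_residue (hρ : 0 < ρ) (n : ℤ) :
    Tendsto (fun μ : ℂ => (μ - latticePoint ρ n) • res (generator T) μ)
      (𝓝[≠] latticePoint ρ n) (𝓝 (I (((ρ : ℝ) : ℂ)⁻¹ • expFun ρ (latticePoint ρ n)))) := by
  have hpos : (0 : ℝ) < 2 * Real.pi / ρ := by positivity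
  have hc : ContinuousAt (fun μ => regularFactor ρ (latticePoint ρ n) μ • expFun ρ μ)
      (latticePoint ρ n) :=
    ((differentiableOn_regularFactor hρ n).continuousOn.continuousAt
      (Metric.ball_mem_nhds _ hpos)).smul (differentiable_expFun ρ).continuous.continuousAt
  have := (I.continuous.continuousAt.comp hc).tendsto.mono_left
    (nhdsWithin_le_nhds (s := {latticePoint ρ n}ᶜ))
  simp only [Function.comp_apply, regularFactor_same hρ] at this
  refine this.congr' ?_
  filter_upwards [self_mem_nhdsWithin, mem_nhdsWithin_of_mem_nhds (Metric.ball_mem_nhds _ hpos)]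
    with μ h1 h2
  rw [mem_ball_iff_norm] at h2
  rw [Function.comp_apply, (res_generator hI hT hcont hTρ hρ (notMem_lattice_of_mem_puncturedDisc
    ⟨norm_pos_iff.2 (sub_ne_zero.2 h1), h2⟩)).2, regularFactor_of_ne hρ h1, ← map_smul, smul_smul]

end Resolvent

end

end LCSemigroup

end

theorem mainTheorem8 {X : Type*} [AddCommGroup X] [Module ℂ X] [UniformSpace X]
    [IsUniformAddGroup X] [ContinuousSMul ℂ X] [LocallyConvexSpace ℝ X] [T2Space X]
    (hX : SeqComplete X)
    (T : ℝ≥0 → X →L[ℂ] X) (hT : IsSemigroup T) (hcont : IsStronglyContinuous T)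
    (hequi : IsLocallyEquicontinuous T) (hper : IsPeriodic T)
    (ρ : ℝ≥0) (hρ : period T = ρ) (hρ_pos : 0 < ρ)
    (A : X →ₗ.[ℂ] X) (hA : A = generator T) :
    -- the spectrum and the formula for the resolvent
    (specStar A ⊆ lattice ρ ∧
      ∀ μ ∉ lattice ρ, ∀ x : X, ∃ y : X,
        HasRiemannIntegral (fun s : ℝ => Complex.exp (-μ * s) • T s.toNNReal x) 0 ρ y ∧
        res A μ x = (1 - Complex.exp (-μ * (ρ : ℝ)))⁻¹ • y) ∧
    -- holomorphy with respect to the topology of uniform convergence on bounded sets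
    DifferentiableOn ℂ (fun μ : ℂ => res A μ) (lattice ρ)ᶜ ∧
    ∃ P : ℤ → X →L[ℂ] X,
      -- the residues
      (∀ n : ℤ,
        Tendsto (fun μ : ℂ => (μ - latticePoint ρ n) • res A μ)
          (𝓝[≠] latticePoint ρ n) (𝓝 (P n)) ∧
        ∀ x : X, ∃ y : X,
          HasRiemannIntegral
            (fun s : ℝ => Complex.exp (-latticePoint ρ n * s) • T s.toNNReal x) 0 ρ y ∧
          P n x = (1 / ((ρ : ℝ) : ℂ)) • y) ∧
      -- the Laurent expansions
      (∃ a : ℤ → ℤ → X →L[ℂ] X,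
        (∀ n : ℤ, a (-1) n = P n) ∧
        (∀ (n : ℤ) (x : X),
          TendstoLocallyUniformlyOn
            (fun (N : ℕ) (μ : ℂ) =>
              ∑ k ∈ Finset.Icc (-1 : ℤ) N, (μ - latticePoint ρ n) ^ k • a k n x)
            (fun μ : ℂ => res A μ x) atTop
            (puncturedDisc (latticePoint ρ n) (2 * Real.pi / ρ))) ∧
        (∀ (n k : ℤ), -1 ≤ k → ∀ r : ℝ, 0 < r → r < 2 * Real.pi / ρ → ∀ x : X, ∃ y : X,
          HasCircleIntegral
            (fun z : ℂ => ((z - latticePoint ρ n) ^ (k + 1))⁻¹ • res A z x)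
            (latticePoint ρ n) r y ∧
          a k n x = (1 / (2 * (Real.pi : ℂ) * Complex.I)) • y) ∧
        -- the addendum on convergence in the space of operators
        (SeqComplete (X →L[ℂ] X) →
          (∀ n : ℤ,
            TendstoLocallyUniformlyOn
              (fun (N : ℕ) (μ : ℂ) =>
                ∑ k ∈ Finset.Icc (-1 : ℤ) N, (μ - latticePoint ρ n) ^ k • a k n)
              (fun μ : ℂ => res A μ) atTop
              (puncturedDisc (latticePoint ρ n) (2 * Real.pi / ρ))) ∧
          (∀ (n k : ℤ), -1 ≤ k → ∀ r : ℝ, 0 < r → r < 2 * Real.pi / ρ → ∃ S : X →L[ℂ] X,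
            HasCircleIntegral
              (fun z : ℂ => ((z - latticePoint ρ n) ^ (k + 1))⁻¹ • res A z)
              (latticePoint ρ n) r S ∧
            a k n = (1 / (2 * (Real.pi : ℂ) * Complex.I)) • S))) ∧
      -- the residues are projections onto the eigenspaces
      (∀ n : ℤ, LinearMap.range (P n : X →ₗ[ℂ] X) = kerScalarSub A (latticePoint ρ n) ∧
        (P n).comp (P n) = P n) ∧
      -- the spectrum consists of eigenvalues
      specStar A = pointSpec A ∧ pointSpec A ⊆ lattice ρ := by
  subst hA
  have hTρ := map_period_eq_id hcont hper hρ
  obtain ⟨I, hI⟩ := exists_isOrbitIntegral hX hcont hequi ρ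
  have hres := fun μ hμ => (res_generator hI hT hcont hTρ hρ_pos (μ := μ) hμ).2
  have hspec := specStar_generator_subset hI hT hcont hTρ hequi hρ_pos
  have heq := specStar_generator_eq hI hT hcont hTρ hequi hρ_pos
  choose α hα0 hαunif hαcirc using exists_laurent_coefficients hρ_pos
  have h2πI : ∀ {Y : Type _} [AddCommGroup Y] [Module ℂ Y] (y : Y),
      y = (1 / (2 * (Real.pi : ℂ) * Complex.I)) • (2 * (Real.pi : ℂ) * Complex.I) • y :=
    fun y => by rw [one_div, inv_smul_smul₀ Complex.two_pi_I_ne_zero]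
  refine ⟨⟨hspec, fun μ hμ x => ⟨_, hI.hasRiemannIntegral hcont μ x, ?_⟩⟩,
    differentiableOn_res_generator hI hT hcont hTρ hρ_pos,
    fun n => I (((ρ : ℝ) : ℂ)⁻¹ • expFun ρ (latticePoint ρ n)),
    fun n => ⟨tendsto_residue hI hT hcont hTρ hρ_pos n, fun x =>
      ⟨_, hI.hasRiemannIntegral hcont _ x, ?_⟩⟩,
    ⟨fun k n => I (α n k), fun n => congrArg I (hα0 n), fun n x => ?_, fun n k hk r hr hrR x => ?_,
      fun _ => ⟨fun n => ?_, fun n k hk r hr hrR => ?_⟩⟩,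
    fun n => ⟨range_residue hI hT hcont hTρ hρ_pos n,
      residue_comp_self hI hT hcont hTρ hρ_pos n⟩, heq, heq ▸ hspec⟩
  · rw [hres μ hμ, map_smul, smul_apply]
    rfl
  · change I _ x = _
    rw [map_smul, smul_apply, one_div]
  · exact tendsto_laurent_map (evalIntegral I x) (fun μ hμ => by rw [hres μ hμ]; rfl) (hαunif n)
  · refine ⟨_, hasCircleIntegral_laurent_map (evalIntegral I x)
      (fun μ hμ => by rw [hres μ hμ]; rfl) hr hrR (hαcirc n k hk r hr hrR), ?_⟩
    rw [map_smul]
    exact h2πI _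
  · exact tendsto_laurent_map I hres (hαunif n)
  · refine ⟨_, hasCircleIntegral_laurent_map I hres hr hrR (hαcirc n k hk r hr hrR), ?_⟩
    rw [map_smul]
    exact h2πI _
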